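/- **Corollary (Analytic Helmholtz solution, high-frequency regime, stability of the edge-and-node interpolant).** *Setting.* Let $\mathcal T_h$ be a finite uniform Cartesian mesh of open rectangular cells of size $h_1\times h_2$, let $\Omega\subset\mathbb R^2$ be the domain it tessellates (the interior of the union of the closed cells), and put $h=\max(h_1,h_2)$, $\rho=h/\min(h_1,h_2)\ge 1$. Let $\Sigma_h$ and $\mathcal N_h$ be the sets of all (interior and boundary) edges and nodes. Let $\kappa>0$ with $\kappa^2\notin\{(n\pi/(2h_1))^2+(m\pi/h_2)^2: n,m\in\mathbb N\}$, where $\mathbb N=\{0,1,\dots\}$ and $\mathbb N^*=\mathbb N\setminus\{0\}$. For $n\in\mathbb N^*$ set $$\widehat\varphi_n(x,y;a,b)=\sin(\kappa\nu x)\,\frac{\sin(y\kappa\sqrt{1-\nu^2})}{\sin(b\kappa\sqrt{1-\nu^2})},\qquad \nu=\frac{n\pi}{\kappa a}$$ (principal square root). The edge functions are $\phi_{\mathbf s,n}(x,y)=\widehat\varphi_n(x-x_{\mathbf s},h_2-|y-y_{\mathbf s}|;h_1,h_2)$ on the two closed cells adjacent to a horizontal edge $\mathbf s=[x_{\mathbf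 s},x_{\mathbf s}+h_1]\times\{y_{\mathbf s}\}$, $\phi_{\mathbf s,n}(x,y)=\widehat\varphi_n(y-y_{\mathbf s},h_1-|x-x_{\mathbf s}|;h_2,h_1)$ on the two closed cells adjacent to a vertical edge $\mathbf s=\{x_{\mathbf s}\}\times[y_{\mathbf s},y_{\mathbf s}+h_2]$, and $0$ elsewhere. The node functions of $\mathbf p=(x_{\mathbf p},y_{\mathbf p})\in\mathcal N_h$ are $\psi_{\mathbf p,m}(x,y)=\widehat\varphi_{2m-1}(h_1+x-x_{\mathbf p},h_2-|y-y_{\mathbf p}|;2h_1,h_2)$ on $[x_{\mathbf p}-h_1,x_{\mathbf p}+h_1]\times[y_{\mathbf p}-h_2,y_{\mathbf p}+h_2]$, and $0$ elsewhere. For $N_{\mathbf e},N_{\mathbf n}\in\mathbb N^*$ and a homogeneous Helmholtz solution $u$ ($-\Delta u-\kappa^2u=0$ in $\Omega$), complex-valued and analytic on $\overline\Omega$, the coefficients $\boldsymbol\beta=(\beta_{\mathbf p,m})_{\mathbf p\in\mathcal N_h,1\le m\le N_{\mathbf n}}$ and $\boldsymbol\alpha=(\alpha_{\mathbf s,n})_{\mathbf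 s\in\Sigma_h,1\le n\le N_{\mathbf e}}$ of the interpolant $\sum\alpha_{\mathbf s,n}\phi_{\mathbf s,n}+\sum\beta_{\mathbf p,m}\psi_{\mathbf p,m}$ are given by $$\sum_{\mathbf p\in\mathcal N_h}\sum_{m=1}^{N_{\mathbf n}}\beta_{\mathbf p,m}(\kappa^{-1}\partial_1)^{2n}\psi_{\mathbf p,m}(\mathbf q)=(\kappa^{-1}\partial_1)^{2n}u(\mathbf q),\qquad \mathbf q\in\mathcal N_h,\ 0\le n\le N_{\mathbf n}-1$$ (even derivatives of $\psi_{\mathbf p,m}$ at nodes being the limits from within adjacent cells), and, with $\mathcal Vu=\sum\beta_{\mathbf p,m}\psi_{\mathbf p,m}$, by $\alpha_{\mathbf s,n}=(u-\mathcal Vu,\phi_{\mathbf s,n})_{L^2(\mathbf s)}/\|\phi_{\mathbf s,n}\|^2_{L^2(\mathbf s)}$. Let $\|u\|^2_{H^M_\kappa(\Omega)}=\sum_{|\mathbf a|\le M}\kappa^{-2|\mathbf a|}\|\partial^{\mathbf a}u\|^2_{L^2(\Omega)}$. For $\rho\ge1$ fix the shape of the cells, $(h_1,h_2)=(h,h/\rho)$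 or $(h_1,h_2)=(h/\rho,h)$, and let, as functions of $\kappa h$, $$\widetilde D=1+\frac1{\widetilde{\mathrm d}}+\frac1{\sqrt{\widetilde{\mathrm d}_0}},\quad \widetilde{\mathrm d}=\inf_{m\in\mathbb N,\,n\in\mathbb N^*:\,\widetilde\nu_n<1}\Bigl|\sqrt{1-\widetilde\nu_n^2}-\frac{m\pi}{\kappa h_2}\Bigr|,\quad \widetilde{\mathrm d}_0=\inf_{n\in\mathbb N^*:\,\widetilde\nu_n>1}\sqrt{\widetilde\nu_n^2-1},\quad \widetilde\nu_n=\frac{(2n-1)\pi}{2\kappa h_1},$$ with values in $[0,\infty]$ ($\inf\emptyset=\infty$, $1/0=\infty$). *Statement.* Let $\rho\ge 1$ with $\rho^2\in\mathbb Q$. There is a positive constant $C=C(\rho,\tau_{\mathbf n})$, continuous in $\tau_{\mathbf n}$, such that for either shape and for every unbounded set $\mathcal K\subset(0,\infty)$ with $\sup_{\kappa h\in\mathcal K}\widetilde D/(\kappa h)^2<\infty$ there is a threshold $t_0$ (depending only on $\rho$, the shape and $\mathcal K$) with the following property. For all $\mathcal T_h$ of this shape and all $\kappa$ as above with $\kappa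 h\in\mathcal K$, $\kappa h\ge t_0$, for all $\tau_{\mathbf e},\tau_{\mathbf n}\ge1$ such that $N_{\mathbf e}=\frac{\tau_{\mathbf e}}\pi\kappa h$ and $N_{\mathbf n}=\frac{\tau_{\mathbf n}}\pi\kappa h$ are in $\mathbb N^*$, and for every homogeneous Helmholtz solution $u$ analytic on $\overline\Omega$, the collocation system has a unique solution $\boldsymbol\beta$, and $$\|\boldsymbol\alpha\|_{\ell^2}\le\frac Ch|\mathcal N_h|(\kappa h)^5e^{\kappa h}\|u\|_{H_\kappa^{2N_{\mathbf n}+1}(\Omega)},\qquad \|\boldsymbol\beta\|_{\ell^2}\le\frac Ch\sqrt{|\mathcal N_h|(\kappa h)^3}\,e^{\kappa h}\|u\|_{H_\kappa^{2N_{\mathbf n}+1}(\Omega)}.$$ -/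

import Mathlib

open Filter Topology MeasureTheory
open scoped ENNReal ComplexConjugate

noncomputable section

namespace EdgeNodeTrefftz

/-! ### Partial derivatives, Helmholtz solutions, weighted Sobolev norms -/

/-- Partial derivative in the first variable. -/
def pd1 (f : ℝ × ℝ → ℂ) : ℝ × ℝ → ℂ := fun p => deriv (fun s => f (s, p.2)) p.1

/-- Partial derivative in the second variable. -/
def pd2 (f : ℝ × ℝ → ℂ) : ℝ × ℝ → ℂ := fun p => deriv (fun s => f (p.1, s)) p.2

/-- `u` solves the homogeneous Helmholtz equation `-Δu - κ²u = 0` in `Ω`. -/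
def IsHelmholtzOn (κ : ℝ) (u : ℝ × ℝ → ℂ) (Ω : Set (ℝ × ℝ)) : Prop :=
  ∀ p ∈ Ω, -(pd1 (pd1 u) p + pd2 (pd2 u) p) - (κ : ℂ) ^ 2 * u p = 0

/-- The `κ`-weighted Sobolev norm of order `M` on `Ω`:
the square root of the sum over `|α| ≤ M` of `κ^(-2|α|) ‖∂^α u‖²` in `L²(Ω)`.
It is used only for functions that are analytic in a neighbourhood of the compact closure of `Ω`,
for which weak and classical derivatives coincide. -/
def sobolevNorm (κ : ℝ) (M : ℕ) (Ω : Set (ℝ × ℝ)) (u : ℝ × ℝ → ℂ) : ℝ :=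
  √(∑ k ∈ Finset.range (M + 1), ∑ a ∈ Finset.HasAntidiagonal.antidiagonal k,
      (κ ^ (2 * k))⁻¹ * ∫ p in Ω, ‖(pd1^[a.1] (pd2^[a.2] u)) p‖ ^ 2)

/-! ### Reference modes -/

/-- The Neumann eigenvalues `(nπ/a)² + (mπ/b)²`, `n, m ∈ ℕ`, of `-Δ` on an `a × b` rectangle. -/
def neumannSpectrum (a b : ℝ) : Set ℝ :=
  {r | ∃ n m : ℕ, r = (n * Real.pi / a) ^ 2 + (m * Real.pi / b) ^ 2}

/-- `ν_n = nπ / (κ a)`. -/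
def nuHat (κ a : ℝ) (n : ℕ) : ℝ := n * Real.pi / (κ * a)

/-- Principal square root of `1 - ν_n²`. -/
def modeRoot (κ a : ℝ) (n : ℕ) : ℂ := Complex.sqrt ((1 - nuHat κ a n ^ 2 : ℝ) : ℂ)

/-- The single-edge Helmholtz mode on `(0,a) × (0,b)`:
`sin(κ ν_n x) sin(y κ √(1-ν_n²)) / sin(b κ √(1-ν_n²))`. -/
def phiHat (κ a b : ℝ) (n : ℕ) (x y : ℝ) : ℂ :=
  (Real.sin (κ * nuHat κ a n * x) : ℂ) *
    (Complex.sin (y * κ * modeRoot κ a n) / Complex.sin (b * κ * modeRoot κ a n))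

/-! ### Meshes -/

/-- A finite uniform Cartesian mesh: the cell with index `(i, j)` is the open rectangle of size
`h₁ × h₂` with lower left corner `(x₀ + i h₁, y₀ + j h₂)`. -/
structure Mesh where
  x₀ : ℝ
  y₀ : ℝ
  h₁ : ℝ
  h₂ : ℝ
  h₁_pos : 0 < h₁
  h₂_pos : 0 < h₂
  cells : Finset (ℤ × ℤ)

namespace Mesh

variable (T : Mesh)

/-- The mesh size. -/
def h : ℝ := max T.h₁ T.h₂

/-- The grid point with index `p`. -/
def pt (p : ℤ × ℤ) : ℝ × ℝ := (T.x₀ + p.1 * T.h₁, T.y₀ + p.2 * T.h₂)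

/-- The open cell with index `c`. -/
def cell (c : ℤ × ℤ) : Set (ℝ × ℝ) :=
  Set.Ioo (T.pt c).1 ((T.pt c).1 + T.h₁) ×ˢ Set.Ioo (T.pt c).2 ((T.pt c).2 + T.h₂)

/-- The domain tessellated by the mesh: the interior of the union of the closed cells. -/
def domain : Set (ℝ × ℝ) := interior (⋃ c ∈ T.cells, closure (T.cell c))

/-- The four vertices of the cell with index `c`. -/
def vertices (c : ℤ × ℤ) : Finset (ℤ × ℤ) := {c, c + (1, 0), c + (0, 1), c + (1, 1)}

/-- All mesh nodes, interior and boundary. -/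
def nodes : Finset (ℤ × ℤ) := T.cells.biUnion vertices

/-- All mesh edges, interior and boundary. The edge `Sum.inl s` is the horizontal segment of
length `h₁` going right from the grid point `s`, the edge `Sum.inr s` is the vertical segment of
length `h₂` going up from the grid point `s`. -/
def edges : Finset ((ℤ × ℤ) ⊕ (ℤ × ℤ)) :=
  T.cells.biUnion fun c => {Sum.inl c, Sum.inl (c + (0, 1)), Sum.inr c, Sum.inr (c + (1, 0))}

/-- The `L²` inner product over an edge of (the traces of) two functions that are continuous
across and along the edge. -/
def edgeInner (s : (ℤ × ℤ) ⊕ (ℤ × ℤ)) (f g : ℝ × ℝ → ℂ) : ℂ :=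
  match s with
  | Sum.inl s => ∫ x in (T.pt s).1..(T.pt s).1 + T.h₁,
      f (x, (T.pt s).2) * conj (g (x, (T.pt s).2))
  | Sum.inr s => ∫ y in (T.pt s).2..(T.pt s).2 + T.h₂,
      f ((T.pt s).1, y) * conj (g ((T.pt s).1, y))

/-! ### Edge and node basis functions -/

open Classical in
/-- The edge basis functions: on each of the two cells adjacent to the edge, a reference mode
whose trace is supported on the edge, and zero elsewhere. -/
def edgeBasis (κ : ℝ) (s : (ℤ × ℤ) ⊕ (ℤ × ℤ)) (n : ℕ) : ℝ × ℝ → ℂ :=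
  match s with
  | Sum.inl s => fun p =>
      let xs := (T.pt s).1
      let ys := (T.pt s).2
      if p ∈ Set.Icc xs (xs + T.h₁) ×ˢ Set.Icc ys (ys + T.h₂) then
        phiHat κ T.h₁ T.h₂ n (p.1 - xs) (T.h₂ + (ys - p.2))
      else if p ∈ Set.Icc xs (xs + T.h₁) ×ˢ Set.Icc (ys - T.h₂) ys then
        phiHat κ T.h₁ T.h₂ n (p.1 - xs) (T.h₂ - (ys - p.2))
      else 0
  | Sum.inr s => fun p =>
      let xs := (T.pt s).1
      let ys := (T.pt s).2
      if p ∈ Set.Icc xs (xs + T.h₁) ×ˢ Set.Icc ys (ys + T.h₂) then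
        phiHat κ T.h₂ T.h₁ n (p.2 - ys) (T.h₁ + (xs - p.1))
      else if p ∈ Set.Icc (xs - T.h₁) xs ×ˢ Set.Icc ys (ys + T.h₂) then
        phiHat κ T.h₂ T.h₁ n (p.2 - ys) (T.h₁ - (xs - p.1))
      else 0

open Classical in
/-- The node basis functions (`n ≥ 1`): on each of the two coarse cells of size `2h₁ × h₂` above
and below the node, a reference mode of odd index `2n - 1`, and zero elsewhere. -/
def nodeBasis (κ : ℝ) (q : ℤ × ℤ) (n : ℕ) : ℝ × ℝ → ℂ := fun p =>
  let xp := (T.pt q).1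
  let yp := (T.pt q).2
  if p ∈ Set.Icc (xp - T.h₁) (xp + T.h₁) ×ˢ Set.Icc yp (yp + T.h₂) then
    phiHat κ (2 * T.h₁) T.h₂ (2 * n - 1) (T.h₁ - (xp - p.1)) (T.h₂ + (yp - p.2))
  else if p ∈ Set.Icc (xp - T.h₁) (xp + T.h₁) ×ˢ Set.Icc (yp - T.h₂) yp then
    phiHat κ (2 * T.h₁) T.h₂ (2 * n - 1) (T.h₁ - (xp - p.1)) (T.h₂ - (yp - p.2))
  else 0

/-! ### Coefficients of the combined interpolant -/

/-- The nodal collocation system: for all `0 ≤ n ≤ N - 1` and all mesh nodes `q`,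
`∑_p ∑_{m=1}^N β_{p,m} (κ⁻¹∂₁)^(2n) ψ_{p,m} (q) = (κ⁻¹∂₁)^(2n) u (q)`.
The node functions are analytic on every open cell, and their even derivatives at a node are
the limits from within the cells that have this node as a vertex.
The component `m : Fin N` of `β` belongs to the node function of index `m + 1`. -/
def IsCollocation (κ : ℝ) (N : ℕ) (u : ℝ × ℝ → ℂ) (β : T.nodes → Fin N → ℂ) : Prop :=
  ∀ n < N, ∀ c ∈ T.cells, ∀ q ∈ vertices c,
    Tendsto
      (fun x => ∑ p : T.nodes, ∑ m : Fin N,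
        β p m * (((κ : ℂ) ^ (2 * n))⁻¹ * (pd1^[2 * n] (T.nodeBasis κ p (m + 1))) x))
      (𝓝[T.cell c] (T.pt q))
      (𝓝 (((κ : ℂ) ^ (2 * n))⁻¹ * (pd1^[2 * n] u) (T.pt q)))

/-- The nodal interpolant with coefficients `β`. -/
def nodalInterpolant (κ : ℝ) {N : ℕ} (β : T.nodes → Fin N → ℂ) : ℝ × ℝ → ℂ := fun x =>
  ∑ p : T.nodes, ∑ m : Fin N, β p m * T.nodeBasis κ p (m + 1) x

/-- The edge coefficients `α_{s,n} = (u - 𝒱u, φ_{s,n}) / ‖φ_{s,n}‖²`, in `L²(s)`, where `𝒱u` is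
the nodal interpolant with coefficients `β`. -/
def edgeCoeff (κ : ℝ) {N : ℕ} (u : ℝ × ℝ → ℂ) (β : T.nodes → Fin N → ℂ)
    (s : (ℤ × ℤ) ⊕ (ℤ × ℤ)) (n : ℕ) : ℂ :=
  T.edgeInner s (u - T.nodalInterpolant κ β) (T.edgeBasis κ s n) /
    T.edgeInner s (T.edgeBasis κ s n) (T.edgeBasis κ s n)

/-- The `ℓ²` norm of the vector of edge coefficients, `s` an edge and `1 ≤ n ≤ Ne`. -/
def edgeCoeffNorm (κ : ℝ) {N : ℕ} (Ne : ℕ) (u : ℝ × ℝ → ℂ) (β : T.nodes → Fin N → ℂ) : ℝ :=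
  √(∑ s ∈ T.edges, ∑ n ∈ Finset.Icc 1 Ne, ‖T.edgeCoeff κ u β s n‖ ^ 2)

/-- The `ℓ²` norm of the vector of node coefficients. -/
def nodeCoeffNorm {N : ℕ} (β : T.nodes → Fin N → ℂ) : ℝ :=
  √(∑ p : T.nodes, ∑ m : Fin N, ‖β p m‖ ^ 2)

end Mesh

/-! ### Distance to the node-associated resonances

The infima and the quotients are taken in `[0, ∞]`, so that the infimum of the empty set is `∞`
and `1 / 0 = ∞`. The arguments are `a = κ h₁` and `b = κ h₂`. -/

/-- `(2n-1)π / (2 κ h₁)`. -/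
def nuTilde (a : ℝ) (n : ℕ) : ℝ := (2 * n - 1) * Real.pi / (2 * a)

def dTilde (a b : ℝ) : ℝ≥0∞ :=
  ⨅ (m : ℕ) (n : ℕ) (_ : 1 ≤ n) (_ : nuTilde a n < 1),
    ENNReal.ofReal |√(1 - nuTilde a n ^ 2) - m * Real.pi / b|

def dTildeZero (a : ℝ) : ℝ≥0∞ :=
  ⨅ (n : ℕ) (_ : 1 ≤ n) (_ : 1 < nuTilde a n), ENNReal.ofReal √(nuTilde a n ^ 2 - 1)

def DTilde (a b : ℝ) : ℝ≥0∞ := 1 + (dTilde a b)⁻¹ + (dTildeZero a ^ (1 / 2 : ℝ))⁻¹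

/-- `K ⊆ (0, ∞)` is an unbounded set of values `t = κ h` along which the resonance indicator of
cells with `h₁ = σ₁ h`, `h₂ = σ₂ h` grows at most quadratically in `t`. -/
def IsAdmissible (σ₁ σ₂ : ℝ) (K : Set ℝ) : Prop :=
  K ⊆ Set.Ioi 0 ∧ ¬ BddAbove K ∧
    ⨆ t ∈ K, DTilde (σ₁ * t) (σ₂ * t) / ENNReal.ofReal (t ^ 2) < ∞

end EdgeNodeTrefftz

end

noncomputable section

namespace EdgeNodeTrefftz

/-! ### Products over the odd integers -/

/-! Node coefficients. A node function is a horizontal sine times a vertical factor, equals `±1` at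
its own node and `0` at every other node, and `(κ⁻¹∂₁)²` multiplies it by `-ν²` inside cells, with
`ν = (2m+1)π/(2κh₁)`. Hence the collocation system splits into one Vandermonde system per node with
distinct nodes `-ν²` (`isCollocation_iff`), which gives unique solvability. For the size, pair the
equations with the coefficients of `∏_{i≠m} (X + ν_i²)`: they are nonnegative, so their sum is the
value at `1`, and the inverse is controlled by `∏_{i≠m} (1 + ν_i²) / |ν_i² - ν_m²|`. Writing `1 +
ν_i² = ν_i² (1 + ν_i⁻²)`, the factors `1 + ν_i⁻²` multiply to at most `cosh (κh₁)` by Euler's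
product, and a factorial count bounds the rest by `2` (`norm_le_of_odd_moments`). This is the origin
of `e^{κh}`. The data are point values of derivatives at cell corners, bounded by `4κ` times the
Sobolev norm through two one-dimensional trace inequalities.

Edge coefficients. On its edge, an edge function is a pure sine, so Bessel's inequality bounds the
coefficients there by the `L²` norm of `u - 𝒱u` on the edge. The trace of `u` is again bounded by
the Sobolev norm. For `𝒱u`, only four nodes act on a cell, and each vertical factor is at most `1`
(evanescent) or `1/|sin|` (propagating). Admissibility keeps the phase at distance of order
`κh₂/(κh)²` from the multiples of `π`, so that `1/|sin| ≤ (κh)²` beyond the threshold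
(`one_le_mul_abs_sin_of_DTilde_le`). Summing over nodes and edges and substituting `κ = (κh)/h`
yields the powers. -/

theorem tendsto_euler_sinh_prod (x : ℝ) :
    Tendsto (fun n : ℕ => Real.pi * x * ∏ j ∈ Finset.range n, (1 + x ^ 2 / ((j : ℝ) + 1) ^ 2))
      atTop (𝓝 (Real.sinh (Real.pi * x))) := by
  have h := (Complex.continuous_im.tendsto _).comp
    (Complex.tendsto_euler_sin_prod ((x : ℂ) * Complex.I))
  have e : (Real.pi : ℂ) * ((x : ℂ) * Complex.I) = ((Real.pi * x : ℝ) : ℂ) * Complex.I := by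
    push_cast; ring
  have h2 : (Complex.sin (Real.pi * ((x : ℂ) * Complex.I))).im = Real.sinh (Real.pi * x) := by
    rw [e, Complex.sin_mul_I, ← Complex.ofReal_sinh, Complex.im_ofReal_mul, Complex.I_im, mul_one]
  rw [h2] at h
  refine h.congr fun n => ?_
  have h3 : ∏ j ∈ Finset.range n, ((1 : ℂ) - ((x : ℂ) * Complex.I) ^ 2 / ((j : ℂ) + 1) ^ 2)
      = ((∏ j ∈ Finset.range n, (1 + x ^ 2 / ((j : ℝ) + 1) ^ 2) : ℝ) : ℂ) := by
    push_cast
    refine Finset.prod_congr rfl fun j _ => ?_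
    rw [mul_pow, Complex.I_sq]; ring
  rw [Function.comp_apply, h3, e, mul_right_comm, ← Complex.ofReal_mul]
  simp only [Complex.im_ofReal_mul, Complex.I_im, mul_one]

/-- In Euler's product for `sinh (2a)`, the even factors form the product for `sinh a`. Since `sinh
(2a) = 2 sinh a cosh a`, the odd factors tend to `cosh a`, and their partial products increase. -/
theorem prod_one_add_odd_le_cosh {a : ℝ} (ha : 0 < a) (N : ℕ) :
    ∏ i ∈ Finset.range N, (1 + (2 * a / Real.pi) ^ 2 / (2 * (i : ℝ) + 1) ^ 2) ≤ Real.cosh a := by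
  set x := 2 * a / Real.pi with hx
  have hpi := Real.pi_pos
  have hx0 : 0 < x := by positivity
  set O : ℕ → ℝ := fun n => ∏ i ∈ Finset.range n, (1 + x ^ 2 / (2 * (i : ℝ) + 1) ^ 2) with hO
  set P : ℝ → ℕ → ℝ := fun y n => ∏ j ∈ Finset.range n, (1 + y ^ 2 / ((j : ℝ) + 1) ^ 2) with hP
  have split : ∀ n, P x (2 * n) = O n * P (x / 2) n := by
    intro n
    induction n with
    | zero => simp [hO, hP]
    | succ n ih =>
      have e1 : P x (2 * (n + 1)) = P x (2 * n) * (1 + x ^ 2 / (((2 * n : ℕ) : ℝ) + 1) ^ 2)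
          * (1 + x ^ 2 / (((2 * n + 1 : ℕ) : ℝ) + 1) ^ 2) := by
        simp only [hP]
        rw [show 2 * (n + 1) = 2 * n + 1 + 1 by ring, Finset.prod_range_succ,
          Finset.prod_range_succ]
      have e2 : O (n + 1) = O n * (1 + x ^ 2 / (2 * (n : ℝ) + 1) ^ 2) := by
        simp only [hO, Finset.prod_range_succ]
      have e3 : P (x / 2) (n + 1) = P (x / 2) n * (1 + (x / 2) ^ 2 / ((n : ℝ) + 1) ^ 2) := by
        simp only [hP, Finset.prod_range_succ]
      have e4 : x ^ 2 / (((2 * n + 1 : ℕ) : ℝ) + 1) ^ 2 = (x / 2) ^ 2 / ((n : ℝ) + 1) ^ 2 := by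
        push_cast; field_simp; ring
      rw [e1, e2, e3, ih, e4]; push_cast; ring
  have hmono : Monotone O := by
    refine monotone_nat_of_le_succ fun n => ?_
    simp only [hO, Finset.prod_range_succ]
    refine le_mul_of_one_le_right (Finset.prod_nonneg fun i _ => by positivity) ?_
    have : 0 ≤ x ^ 2 / (2 * (n : ℝ) + 1) ^ 2 := by positivity
    linarith
  have l1 := (tendsto_euler_sinh_prod x).comp
    (tendsto_id.const_mul_atTop' (r := 2) zero_lt_two)
  have l2 := (tendsto_euler_sinh_prod (x / 2)).const_mul (2 * O N)
  -- The odd product is never passed to the limit: for `n ≥ N` one has `O N ≤ O n`, and `O n * P (x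
  -- / 2) n` is a partial Euler product.
  have key : 2 * O N * Real.sinh (Real.pi * (x / 2)) ≤ Real.sinh (Real.pi * x) := by
    refine le_of_tendsto_of_tendsto l2 l1 ?_
    filter_upwards [eventually_ge_atTop N] with n hn
    have h1 : 0 ≤ P (x / 2) n := Finset.prod_nonneg fun i _ => by positivity
    have h2 := mul_le_mul_of_nonneg_right (hmono hn) h1
    have h3 := split n
    simp only [Function.comp_apply, id]
    change 2 * O N * (Real.pi * (x / 2) * P (x / 2) n) ≤ Real.pi * x * P x (2 * n)
    rw [h3]
    nlinarith [mul_le_mul_of_nonneg_left h2 (mul_pos hpi hx0).le]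
  have e1 : Real.pi * (x / 2) = a := by rw [hx]; field_simp
  have e2 : Real.pi * x = 2 * a := by rw [hx]; field_simp
  rw [e1, e2, Real.sinh_two_mul] at key
  have hs : 0 < Real.sinh a := Real.sinh_pos_iff.2 ha
  nlinarith

/-- The right side increases with `m`: each step trades a factor `N - 1 - m` for the larger `N + m +
1`. -/
theorem factorial_mul_factorial_le {N m : ℕ} (hm : m < N) :
    (N - 1).factorial * N.factorial ≤ (N - 1 - m).factorial * (N + m).factorial := by
  induction m with
  | zero => simp
  | succ m ih =>
    refine (ih (by omega)).trans ?_
    have e : (N - 1 - m) = (N - 1 - (m + 1)) + 1 := by omega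
    rw [e, ← add_assoc, Nat.factorial_succ (N + m), Nat.factorial_succ]
    have : N - 1 - (m + 1) + 1 ≤ N + m + 1 := by omega
    calc _ = (N - 1 - (m + 1) + 1) * ((N - 1 - (m + 1)).factorial * (N + m).factorial) := by ring
      _ ≤ (N + m + 1) * ((N - 1 - (m + 1)).factorial * (N + m).factorial) :=
        Nat.mul_le_mul_right _ this
      _ = _ := by ring

theorem prod_erase_abs_sub {N m : ℕ} (hm : m < N) :
    ∏ i ∈ (Finset.range N).erase m, |(i : ℝ) - m| = m.factorial * (N - 1 - m).factorial := by
  induction N, hm using Nat.le_induction with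
  | base =>
    have h1 : (Finset.range (m + 1)).erase m = Finset.range m := by
      ext i; simp; omega
    have h2 : ∏ i ∈ Finset.range m, |(i : ℝ) - m| = ∏ i ∈ Finset.range m, ((m - i : ℕ) : ℝ) := by
      refine Finset.prod_congr rfl fun i hi => ?_
      have := Finset.mem_range.1 hi
      rw [Nat.cast_sub this.le, abs_sub_comm, abs_of_nonneg]
      have : (i : ℝ) < m := by exact_mod_cast this
      linarith
    rw [Nat.succ_eq_add_one, h1, h2, ← Nat.cast_prod, ← Finset.prod_range_reflect]
    have h3 : ∏ j ∈ Finset.range m, (m - (m - 1 - j)) = m.factorial := by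
      rw [← Finset.prod_range_add_one_eq_factorial]
      refine Finset.prod_congr rfl fun i hi => ?_
      have := Finset.mem_range.1 hi
      omega
    rw [h3]; simp
  | succ N hN ih =>
    have hN' : m < N := hN
    rw [Finset.range_add_one, Finset.erase_insert_of_ne hN'.ne', Finset.prod_insert (by simp), ih,
      show N + 1 - 1 - m = (N - 1 - m) + 1 by omega, Nat.factorial_succ, abs_of_nonneg]
    · push_cast [show m ≤ N - 1 by omega, show 1 ≤ N by omega]
      ring
    · have : (m : ℝ) < N := by exact_mod_cast hN'
      linarith

theorem prod_range_add_add_one (N m : ℕ) :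
    (m.factorial : ℝ) * ∏ i ∈ Finset.range N, ((i : ℝ) + m + 1) = (N + m).factorial := by
  induction N with
  | zero => simp
  | succ N ih =>
    rw [Finset.prod_range_succ, ← mul_assoc, ih, show N + 1 + m = N + m + 1 by ring,
      Nat.factorial_succ]
    push_cast; ring

/-- The step ratio `(2N+3)² / (4(N+1)(N+2))` slightly exceeds `1`, so an induction with the constant
`2` would not close; the increasing factor `2 - 1/(N+1)` absorbs the excess. -/
theorem prod_odd_sq_le (N : ℕ) :
    ∏ i ∈ Finset.range (N + 1), (2 * (i : ℝ) + 1) ^ 2 ≤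
      (2 - 1 / ((N : ℝ) + 1)) * (4 ^ N * N.factorial * (N + 1).factorial) := by
  induction N with
  | zero => norm_num
  | succ N ih =>
    rw [Finset.prod_range_succ]
    have h := mul_le_mul_of_nonneg_right ih (sq_nonneg (2 * ((N + 1 : ℕ) : ℝ) + 1))
    refine h.trans ?_
    rw [Nat.factorial_succ (N + 1), Nat.factorial_succ N]
    push_cast
    set F : ℝ := (N.factorial : ℝ)
    set M : ℝ := (N : ℝ)
    have hM0 : 0 ≤ M := by positivity
    have : (2 - 1 / (M + 1)) * (2 * (M + 1) + 1) ^ 2 ≤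
        (2 - 1 / (M + 1 + 1)) * (4 * (M + 1) * (M + 1 + 1)) := by
      have h1 : (2 - 1 / (M + 1)) = (2 * M + 1) / (M + 1) := by field_simp; ring
      have h2 : (2 - 1 / (M + 1 + 1)) = (2 * M + 3) / (M + 1 + 1) := by field_simp; ring
      rw [h1, h2, div_mul_eq_mul_div, div_mul_eq_mul_div, div_le_div_iff₀ (by linarith) (by linarith)]
      nlinarith [pow_nonneg hM0 2, pow_nonneg hM0 3, pow_nonneg hM0 4]
    have hF : 0 ≤ F * F * 4 ^ N * (M + 1) := by positivity
    calc _ = ((2 - 1 / (M + 1)) * (2 * (M + 1) + 1) ^ 2) * (F * F * 4 ^ N * (M + 1)) := by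
          ring
      _ ≤ _ := mul_le_mul_of_nonneg_right this hF
      _ = _ := by ring

/-- Since `(2i+1)² - (2m+1)² = 4(i-m)(i+m+1)`, with `N = n + 1` the product on the right is `4ⁿ
(n-m)! (n+1+m)! / (2m+1)`. The factorials are smallest at `m = 0`, where `prod_odd_sq_le` compares
them with the odd squares. -/
theorem prod_erase_odd_sq_div_le {N m : ℕ} (hm : m < N) :
    ∏ i ∈ (Finset.range N).erase m, (2 * (i : ℝ) + 1) ^ 2 ≤
      2 * ∏ i ∈ (Finset.range N).erase m, |(2 * (i : ℝ) + 1) ^ 2 - (2 * (m : ℝ) + 1) ^ 2| := by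
  obtain ⟨n, rfl⟩ : ∃ n, N = n + 1 := ⟨N - 1, by omega⟩
  have hmem : m ∈ Finset.range (n + 1) := Finset.mem_range.2 hm
  have e1 : ∏ i ∈ (Finset.range (n + 1)).erase m, |(2 * (i : ℝ) + 1) ^ 2 - (2 * (m : ℝ) + 1) ^ 2|
      = 4 ^ n * (∏ i ∈ (Finset.range (n + 1)).erase m, |(i : ℝ) - m|) *
        ∏ i ∈ (Finset.range (n + 1)).erase m, ((i : ℝ) + m + 1) := by
    have : (4 : ℝ) ^ n = ∏ i ∈ (Finset.range (n + 1)).erase m, (4 : ℝ) := by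
      rw [Finset.prod_const, Finset.card_erase_of_mem hmem]; simp
    rw [this, ← Finset.prod_mul_distrib, ← Finset.prod_mul_distrib]
    refine Finset.prod_congr rfl fun i _ => ?_
    rw [show (2 * (i : ℝ) + 1) ^ 2 - (2 * (m : ℝ) + 1) ^ 2
      = 4 * ((i : ℝ) - m) * ((i : ℝ) + m + 1) by ring, abs_mul, abs_mul,
      abs_of_pos (by positivity : (0 : ℝ) < (i : ℝ) + m + 1), abs_of_pos (by norm_num : (0:ℝ) < 4)]
  have e2 := Finset.mul_prod_erase (Finset.range (n + 1)) (fun i => (i : ℝ) + m + 1) hmem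
  have e3 := Finset.mul_prod_erase (Finset.range (n + 1)) (fun i => (2 * (i : ℝ) + 1) ^ 2) hmem
  have e4 := prod_range_add_add_one (n + 1) m
  have e5 := prod_odd_sq_le n
  have e6 : ((n.factorial * (n + 1).factorial : ℕ) : ℝ) ≤
      ((n - m).factorial * (n + 1 + m).factorial : ℕ) := by
    exact_mod_cast (by simpa using factorial_mul_factorial_le hm)
  have e7 := prod_erase_abs_sub hm
  simp only [add_tsub_cancel_right] at e7
  rw [e1, e7]
  set A := ∏ i ∈ (Finset.range (n + 1)).erase m, (2 * (i : ℝ) + 1) ^ 2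
  set B := ∏ i ∈ (Finset.range (n + 1)).erase m, ((i : ℝ) + m + 1)
  rw [← e3] at e5
  rw [← e2] at e4
  push_cast at e6
  have hm0 : (0 : ℝ) < 2 * m + 1 := by positivity
  have hA : 0 ≤ A := Finset.prod_nonneg fun i _ => by positivity
  have hF : (0 : ℝ) ≤ 4 ^ n * n.factorial * (n + 1).factorial := by positivity
  have h1 : (2 * (m : ℝ) + 1) ^ 2 * A ≤ 2 * (4 ^ n * n.factorial * (n + 1).factorial) := by
    refine e5.trans (mul_le_mul_of_nonneg_right ?_ hF)
    have : (0 : ℝ) ≤ 1 / ((n : ℝ) + 1) := by positivity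
    linarith
  have h2 : (2 * (m : ℝ) + 1) * A ≤ (2 * (m : ℝ) + 1) ^ 2 * A := by
    refine mul_le_mul_of_nonneg_right ?_ hA
    have : (0 : ℝ) ≤ m := by positivity
    nlinarith
  have h3 : (4 : ℝ) ^ n * n.factorial * (n + 1).factorial ≤
      4 ^ n * ((n - m).factorial * (n + 1 + m).factorial) := by
    rw [mul_assoc]
    exact mul_le_mul_of_nonneg_left e6 (by positivity)
  have h4 : (4 : ℝ) ^ n * ((n - m).factorial * (n + 1 + m).factorial) =
      (2 * m + 1) * (4 ^ n * (m.factorial * (n - m).factorial) * B) := by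
    rw [← e4]; ring
  have h5 : (2 * (m : ℝ) + 1) * A ≤
      (2 * m + 1) * (2 * (4 ^ n * (m.factorial * (n - m).factorial) * B)) := by linarith
  exact le_of_mul_le_mul_left h5 hm0

/-! ### Vandermonde systems with nonpositive nodes -/

theorem coeff_prod_X_add_C_nonneg {ι : Type*} (s : Finset ι) {c : ι → ℝ} (hc : ∀ i, 0 ≤ c i)
    (n : ℕ) : 0 ≤ (∏ i ∈ s, (Polynomial.X + Polynomial.C (c i))).coeff n := by
  classical
  induction s using Finset.induction_on generalizing n with
  | empty => simp only [Finset.prod_empty, Polynomial.coeff_one]; split_ifs <;> norm_num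
  | insert i s hi ih =>
    rw [Finset.prod_insert hi, add_mul, Polynomial.coeff_add, Polynomial.coeff_C_mul]
    refine add_nonneg ?_ (mul_nonneg (hc i) (ih n))
    cases n with
    | zero => simp
    | succ n => rw [Polynomial.coeff_X_mul]; exact ih n

/-- The polynomial `∏_{i≠m} (X + c_i)` vanishes at every node `-c_j` with `j ≠ m`, so combining the
equations with its coefficients isolates `γ m`. The coefficients are nonnegative, so their absolute
sum is the value at `1`. -/
theorem norm_mul_prod_le_of_moments {N : ℕ} {c : ℕ → ℝ} (hc : ∀ i, 0 ≤ c i) {γ : ℕ → ℂ}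
    {f : ℕ → ℂ} {F : ℝ} (hf : ∀ n < N, ‖f n‖ ≤ F)
    (h : ∀ n < N, ∑ m ∈ Finset.range N, γ m * (-(c m : ℂ)) ^ n = f n) {m : ℕ} (hm : m < N) :
    ‖γ m‖ * ∏ i ∈ (Finset.range N).erase m, |c i - c m| ≤
      (∏ i ∈ (Finset.range N).erase m, (1 + c i)) * F := by
  have hmem : m ∈ Finset.range N := Finset.mem_range.2 hm
  set p : Polynomial ℝ :=
    ∏ i ∈ (Finset.range N).erase m, (Polynomial.X + Polynomial.C (c i)) with hp
  have hdeg : p.natDegree < N := by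
    refine lt_of_le_of_lt (Polynomial.natDegree_prod_le _ _) ?_
    simp only [Polynomial.natDegree_X_add_C, Finset.sum_const, smul_eq_mul, mul_one]
    rw [Finset.card_erase_of_mem hmem, Finset.card_range]; omega
  have hev : ∀ x : ℝ, p.eval x = ∏ i ∈ (Finset.range N).erase m, (x + c i) := fun x => by
    simp [hp, Polynomial.eval_prod]
  have e1 : ∑ n ∈ Finset.range N, (p.coeff n : ℂ) * f n = γ m * (p.eval (-c m) : ℝ) := by
    calc _ = ∑ n ∈ Finset.range N, ∑ j ∈ Finset.range N,
            γ j * ((p.coeff n * (-c j) ^ n : ℝ) : ℂ) := by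
          refine Finset.sum_congr rfl fun n hn => ?_
          rw [← h n (Finset.mem_range.1 hn), Finset.mul_sum]
          refine Finset.sum_congr rfl fun j _ => ?_
          push_cast; ring
      _ = ∑ j ∈ Finset.range N, γ j * ((p.eval (-c j) : ℝ) : ℂ) := by
          rw [Finset.sum_comm]
          refine Finset.sum_congr rfl fun j _ => ?_
          rw [← Finset.mul_sum, ← Complex.ofReal_sum, Polynomial.eval_eq_sum_range' hdeg]
      _ = _ := by
          refine Finset.sum_eq_single_of_mem m hmem fun j hj hjm => ?_
          have : p.eval (-c j) = 0 := by
            rw [hev]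
            exact Finset.prod_eq_zero (Finset.mem_erase.2 ⟨hjm, hj⟩) (by ring)
          rw [this]; simp
  have e2 : ‖γ m‖ * ∏ i ∈ (Finset.range N).erase m, |c i - c m| =
      ‖∑ n ∈ Finset.range N, (p.coeff n : ℂ) * f n‖ := by
    rw [e1, norm_mul, Complex.norm_real, hev, Real.norm_eq_abs, Finset.abs_prod]
    congr 1
    exact Finset.prod_congr rfl fun i _ => by congr 1; ring
  have e3 : ∏ i ∈ (Finset.range N).erase m, (1 + c i) = ∑ n ∈ Finset.range N, p.coeff n := by
    rw [← hev, Polynomial.eval_eq_sum_range' hdeg]; simp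
  rw [e2, e3, Finset.sum_mul]
  refine norm_sum_le_of_le _ fun n hn => ?_
  have h0 := coeff_prod_X_add_C_nonneg ((Finset.range N).erase m) hc n
  rw [norm_mul, Complex.norm_real, Real.norm_eq_abs, abs_of_nonneg h0]
  exact mul_le_mul_of_nonneg_left (hf n (Finset.mem_range.1 hn)) h0

theorem norm_le_of_odd_moments {N : ℕ} {a : ℝ} (ha : 0 < a) {γ : ℕ → ℂ} {f : ℕ → ℂ} {F : ℝ}
    (hf : ∀ n < N, ‖f n‖ ≤ F)
    (h : ∀ n < N, ∑ m ∈ Finset.range N,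
      γ m * (-(((2 * (m : ℝ) + 1) * Real.pi / (2 * a)) ^ 2 : ℝ) : ℂ) ^ n = f n)
    {m : ℕ} (hm : m < N) : ‖γ m‖ ≤ 2 * Real.exp a * F := by
  have hpi := Real.pi_pos
  set c : ℕ → ℝ := fun i => ((2 * (i : ℝ) + 1) * Real.pi / (2 * a)) ^ 2 with hc
  have key := norm_mul_prod_le_of_moments (c := c) (fun i => by positivity) hf h hm
  set s := (Finset.range N).erase m
  have hF : 0 ≤ F := (norm_nonneg _).trans (hf m hm)
  set w : ℝ := (Real.pi / (2 * a)) ^ 2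
  have hw : 0 < w := by positivity
  have c1 : ∀ i, c i = w * (2 * (i : ℝ) + 1) ^ 2 := fun i => by simp only [hc, w]; ring
  have e1 : ∏ i ∈ s, |c i - c m| =
      w ^ s.card * ∏ i ∈ s, |(2 * (i : ℝ) + 1) ^ 2 - (2 * (m : ℝ) + 1) ^ 2| := by
    rw [← Finset.prod_const, ← Finset.prod_mul_distrib]
    refine Finset.prod_congr rfl fun i _ => ?_
    rw [c1, c1, ← mul_sub, abs_mul, abs_of_pos hw]
  -- Here `w⁻¹ = (2a/π)²`, so pulling `c i` out of `1 + c i` leaves the factors of the `cosh`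
  -- product; the powers of `w` cancel against `e1`.
  have e2 : ∏ i ∈ s, (1 + c i) = w ^ s.card * (∏ i ∈ s, (2 * (i : ℝ) + 1) ^ 2) *
      ∏ i ∈ s, (1 + (2 * a / Real.pi) ^ 2 / (2 * (i : ℝ) + 1) ^ 2) := by
    rw [← Finset.prod_const, ← Finset.prod_mul_distrib, ← Finset.prod_mul_distrib]
    refine Finset.prod_congr rfl fun i _ => ?_
    simp only [hc, w]; field_simp; ring
  have e3 : ∏ i ∈ s, (1 + (2 * a / Real.pi) ^ 2 / (2 * (i : ℝ) + 1) ^ 2) ≤ Real.exp a := by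
    have h0 : ∀ i : ℕ, 0 ≤ (2 * a / Real.pi) ^ 2 / (2 * (i : ℝ) + 1) ^ 2 := fun i => by positivity
    refine (Finset.prod_le_prod_of_subset_of_one_le (Finset.erase_subset _ _)
      (fun i _ => by linarith [h0 i]) (fun i _ _ => by linarith [h0 i])).trans
      ((prod_one_add_odd_le_cosh ha N).trans ?_)
    rw [Real.cosh_eq]
    have : Real.exp (-a) ≤ Real.exp a := Real.exp_le_exp.2 (by linarith)
    linarith
  have e4 := prod_erase_odd_sq_div_le hm
  have hQ : 0 < ∏ i ∈ s, |(2 * (i : ℝ) + 1) ^ 2 - (2 * (m : ℝ) + 1) ^ 2| := by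
    refine Finset.prod_pos fun i hi => abs_pos.2 ?_
    have hne : (i : ℝ) ≠ m := by exact_mod_cast (Finset.mem_erase.1 hi).1
    rw [show (2 * (i : ℝ) + 1) ^ 2 - (2 * (m : ℝ) + 1) ^ 2
      = 4 * ((i : ℝ) - m) * ((i : ℝ) + m + 1) by ring]
    have : (0 : ℝ) < (i : ℝ) + m + 1 := by positivity
    exact mul_ne_zero (mul_ne_zero (by norm_num) (sub_ne_zero.2 hne)) this.ne'
  rw [e1, e2] at key
  set Q := ∏ i ∈ s, |(2 * (i : ℝ) + 1) ^ 2 - (2 * (m : ℝ) + 1) ^ 2|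
  set A := ∏ i ∈ s, (2 * (i : ℝ) + 1) ^ 2
  set B := ∏ i ∈ s, (1 + (2 * a / Real.pi) ^ 2 / (2 * (i : ℝ) + 1) ^ 2)
  have hB : 0 ≤ B := Finset.prod_nonneg fun i _ => by positivity
  have hwc : 0 < w ^ s.card := by positivity
  have h1 : (w ^ s.card * Q) * ‖γ m‖ ≤ (w ^ s.card * Q) * (2 * Real.exp a * F) := by
    calc _ = ‖γ m‖ * (w ^ s.card * Q) := by ring
      _ ≤ w ^ s.card * A * B * F := key
      _ ≤ w ^ s.card * (2 * Q) * Real.exp a * F := by gcongr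
      _ = _ := by ring
  exact le_of_mul_le_mul_left h1 (by positivity)

theorem existsUnique_moments {N : ℕ} {z : Fin N → ℂ} (hz : Function.Injective z) {ε : Fin N → ℂ}
    (hε : ∀ m, ε m ≠ 0) (f : ℕ → ℂ) :
    ∃! γ : Fin N → ℂ, ∀ n < N, ∑ m, γ m * (ε m * z m ^ n) = f n := by
  have hdet : IsUnit (Matrix.vandermonde z).det :=
    isUnit_iff_ne_zero.2 (Matrix.det_vandermonde_ne_zero_iff.2 hz)
  have hu : IsUnit (Matrix.vandermonde z) := (Matrix.isUnit_iff_isUnit_det _).2 hdet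
  have hsurj := (Matrix.vecMul_surjective_iff_isUnit (A := Matrix.vandermonde z)).2 hu
  have hinj := (Matrix.vecMul_injective_iff_isUnit (A := Matrix.vandermonde z)).2 hu
  obtain ⟨g, hg⟩ := hsurj fun n => f n
  refine ⟨fun m => g m / ε m, fun n hn => ?_, fun γ hγ => ?_⟩
  · have := congrFun hg ⟨n, hn⟩
    simp only [Matrix.vecMul, dotProduct, Matrix.vandermonde_apply] at this
    rw [← this]
    refine Finset.sum_congr rfl fun m _ => ?_
    have := hε m
    field_simp
  · have : (fun m => γ m * ε m) = g := by
      refine hinj ?_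
      rw [hg]
      funext n
      simp only [Matrix.vecMul, dotProduct, Matrix.vandermonde_apply]
      rw [← hγ n n.2]
      exact Finset.sum_congr rfl fun m _ => by ring
    funext m
    rw [← this]
    have := hε m
    field_simp

/-! ### Partial derivatives of analytic functions -/

theorem hasDerivAt_fst_of_differentiableAt {f : ℝ × ℝ → ℂ} {p : ℝ × ℝ}
    (h : DifferentiableAt ℝ f p) :
    HasDerivAt (fun s => f (s, p.2)) (fderiv ℝ f p (1, 0)) p.1 :=
  HasFDerivAt.comp_hasDerivAt (l := f) (f := fun s => (s, p.2)) p.1 h.hasFDerivAt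
    ((hasDerivAt_id p.1).prodMk (hasDerivAt_const p.1 p.2))

theorem hasDerivAt_snd_of_differentiableAt {f : ℝ × ℝ → ℂ} {p : ℝ × ℝ}
    (h : DifferentiableAt ℝ f p) :
    HasDerivAt (fun s => f (p.1, s)) (fderiv ℝ f p (0, 1)) p.2 :=
  HasFDerivAt.comp_hasDerivAt (l := f) (f := fun s => (p.1, s)) p.2 h.hasFDerivAt
    ((hasDerivAt_const p.2 p.1).prodMk (hasDerivAt_id p.2))

theorem pd1_eq_fderiv {f : ℝ × ℝ → ℂ} {p : ℝ × ℝ} (h : AnalyticAt ℝ f p) :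
    pd1 f p = fderiv ℝ f p (1, 0) :=
  (hasDerivAt_fst_of_differentiableAt h.differentiableAt).deriv

theorem pd2_eq_fderiv {f : ℝ × ℝ → ℂ} {p : ℝ × ℝ} (h : AnalyticAt ℝ f p) :
    pd2 f p = fderiv ℝ f p (0, 1) :=
  (hasDerivAt_snd_of_differentiableAt h.differentiableAt).deriv

theorem pd1_eventuallyEq {f : ℝ × ℝ → ℂ} {p : ℝ × ℝ} (h : AnalyticAt ℝ f p) :
    pd1 f =ᶠ[𝓝 p] fun x => fderiv ℝ f x (1, 0) := by
  filter_upwards [h.eventually_analyticAt] with x hx using pd1_eq_fderiv hx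

theorem pd2_eventuallyEq {f : ℝ × ℝ → ℂ} {p : ℝ × ℝ} (h : AnalyticAt ℝ f p) :
    pd2 f =ᶠ[𝓝 p] fun x => fderiv ℝ f x (0, 1) := by
  filter_upwards [h.eventually_analyticAt] with x hx using pd2_eq_fderiv hx

theorem _root_.AnalyticAt.pd1 {f : ℝ × ℝ → ℂ} {p : ℝ × ℝ} (h : AnalyticAt ℝ f p) :
    AnalyticAt ℝ (pd1 f) p :=
  (((ContinuousLinearMap.apply ℝ ℂ ((1 : ℝ), (0 : ℝ))).analyticAt _).comp h.fderiv).congr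
    (pd1_eventuallyEq h).symm

theorem _root_.AnalyticAt.pd2 {f : ℝ × ℝ → ℂ} {p : ℝ × ℝ} (h : AnalyticAt ℝ f p) :
    AnalyticAt ℝ (pd2 f) p :=
  (((ContinuousLinearMap.apply ℝ ℂ ((0 : ℝ), (1 : ℝ))).analyticAt _).comp h.fderiv).congr
    (pd2_eventuallyEq h).symm

theorem _root_.AnalyticAt.iterate_pd1 {f : ℝ × ℝ → ℂ} {p : ℝ × ℝ} (h : AnalyticAt ℝ f p) (k : ℕ) :
    AnalyticAt ℝ (EdgeNodeTrefftz.pd1^[k] f) p := by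
  induction k with
  | zero => exact h
  | succ k ih => rw [Function.iterate_succ_apply']; exact ih.pd1

theorem _root_.AnalyticAt.iterate_pd2 {f : ℝ × ℝ → ℂ} {p : ℝ × ℝ} (h : AnalyticAt ℝ f p) (k : ℕ) :
    AnalyticAt ℝ (EdgeNodeTrefftz.pd2^[k] f) p := by
  induction k with
  | zero => exact h
  | succ k ih => rw [Function.iterate_succ_apply']; exact ih.pd2

theorem pd1_congr {f g : ℝ × ℝ → ℂ} {p : ℝ × ℝ} (h : f =ᶠ[𝓝 p] g) : pd1 f p = pd1 g p := by
  have hc : Tendsto (fun s : ℝ => (s, p.2)) (𝓝 p.1) (𝓝 p) := by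
    have : Continuous fun s : ℝ => (s, p.2) := by fun_prop
    exact this.tendsto p.1
  exact (h.comp_tendsto hc).deriv_eq

theorem pd1_pd2_comm {f : ℝ × ℝ → ℂ} {p : ℝ × ℝ} (h : AnalyticAt ℝ f p) :
    pd1 (pd2 f) p = pd2 (pd1 f) p := by
  have hd : DifferentiableAt ℝ (fderiv ℝ f) p := h.fderiv.differentiableAt
  rw [pd1_eq_fderiv h.pd2, pd2_eq_fderiv h.pd1, (pd2_eventuallyEq h).fderiv_eq,
    (pd1_eventuallyEq h).fderiv_eq]
  have e : ∀ v w : ℝ × ℝ, fderiv ℝ (fun x => fderiv ℝ f x v) p w = fderiv ℝ (fderiv ℝ f) p w v := by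
    intro v w
    rw [fderiv_clm_apply hd (differentiableAt_const v)]
    simp
  rw [e, e]
  exact (h.contDiffAt (n := ⊤)).isSymmSndFDerivAt_of_omega _ _

/-- The trace inequalities produce `∂₂` applied last, while `sobolevNorm` applies it first. The
induction varies the point, because differentiating an identity requires it on a neighbourhood. -/
theorem pd2_iterate_pd1 {f : ℝ × ℝ → ℂ} (k : ℕ) {p : ℝ × ℝ} (h : AnalyticAt ℝ f p) :
    pd2 (pd1^[k] f) p = pd1^[k] (pd2 f) p := by
  induction k generalizing p with
  | zero => rfl
  | succ k ih =>
    rw [Function.iterate_succ_apply', Function.iterate_succ_apply',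
      ← pd1_pd2_comm (h.iterate_pd1 k)]
    refine pd1_congr ?_
    filter_upwards [h.eventually_analyticAt] with x hx using ih hx

/-! ### Trace inequalities -/

/-- Integrate the derivative of an affine weight times `‖f‖²`, the weight being `±1` at `e` and `0`
at the other end. Its slope is at most `κ` by `hab`, and the cross term splits by `2xy ≤ κx² +
κ⁻¹y²`. -/
theorem norm_sq_endpoint_le {f f' : ℝ → ℂ} {a b κ : ℝ} (hκ : 0 < κ) (hab : 1 ≤ κ * (b - a))
    (hf : ∀ x ∈ Set.Icc a b, HasDerivAt f (f' x) x) (hf' : ContinuousOn f' (Set.Icc a b))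
    {e : ℝ} (he : e = a ∨ e = b) :
    ‖f e‖ ^ 2 ≤ 2 * κ * ∫ x in Set.Ioo a b, (‖f x‖ ^ 2 + (κ ^ 2)⁻¹ * ‖f' x‖ ^ 2) := by
  have hL : 0 < b - a := by
    by_contra h
    nlinarith
  have hlt : a ≤ b := by linarith
  have hfc : ContinuousOn f (Set.Icc a b) := fun x hx => (hf x hx).continuousAt.continuousWithinAt
  have hu : Set.uIcc a b = Set.Icc a b := Set.uIcc_of_le hlt
  -- `c` is the endpoint opposite to `e`, where the weight vanishes.
  obtain ⟨c, hc⟩ : ∃ c, (c = b ∧ e = a) ∨ (c = a ∧ e = b) := by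
    rcases he with he | he
    · exact ⟨b, Or.inl ⟨rfl, he⟩⟩
    · exact ⟨a, Or.inr ⟨rfl, he⟩⟩
  have hder : ∀ x ∈ Set.uIcc a b, HasDerivAt (fun x => (x - c) / (b - a) * ‖f x‖ ^ 2)
      (1 / (b - a) * ‖f x‖ ^ 2 + (x - c) / (b - a) * (2 * inner ℝ (f x) (f' x))) x := by
    intro x hx
    rw [hu] at hx
    exact (((hasDerivAt_id x).sub_const c).div_const (b - a)).mul (hf x hx).norm_sq
  have hcont : ContinuousOn
      (fun x => 1 / (b - a) * ‖f x‖ ^ 2 + (x - c) / (b - a) * (2 * inner ℝ (f x) (f' x)))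
      (Set.Icc a b) := by
    fun_prop
  have hint := intervalIntegral.integral_eq_sub_of_hasDerivAt hder
    (ContinuousOn.intervalIntegrable (by rw [hu]; exact hcont))
  have hval : ‖f e‖ ^ 2 =
      (b - c) / (b - a) * ‖f b‖ ^ 2 - (a - c) / (b - a) * ‖f a‖ ^ 2 := by
    rcases hc with ⟨rfl, rfl⟩ | ⟨rfl, rfl⟩ <;> field_simp <;> ring
  rw [hval, ← hint, ← integral_Ioc_eq_integral_Ioo, ← intervalIntegral.integral_of_le hlt,
    ← intervalIntegral.integral_const_mul]
  refine intervalIntegral.integral_mono_on hlt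
    (ContinuousOn.intervalIntegrable (by rw [hu]; exact hcont))
    (ContinuousOn.intervalIntegrable (by rw [hu]; fun_prop)) fun x hx => ?_
  have h1 : 1 / (b - a) ≤ κ := by rw [div_le_iff₀ hL]; exact hab
  have h2 : |(x - c) / (b - a)| ≤ 1 := by
    rw [abs_div, abs_of_pos hL, div_le_one hL, abs_le]
    rcases hc with ⟨rfl, rfl⟩ | ⟨rfl, rfl⟩ <;> constructor <;> linarith [hx.1, hx.2]
  have h3 : |inner ℝ (f x) (f' x)| ≤ ‖f x‖ * ‖f' x‖ := abs_real_inner_le_norm _ _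
  have h4 : (x - c) / (b - a) * (2 * inner ℝ (f x) (f' x)) ≤ 2 * (‖f x‖ * ‖f' x‖) := by
    refine (le_abs_self _).trans ?_
    rw [abs_mul, abs_mul, abs_two]
    calc _ ≤ 1 * (2 * (‖f x‖ * ‖f' x‖)) := by gcongr
      _ = _ := one_mul _
  have h5 : 2 * (‖f x‖ * ‖f' x‖) ≤ κ * ‖f x‖ ^ 2 + κ⁻¹ * ‖f' x‖ ^ 2 := by
    have h6 : 0 ≤ κ * (‖f x‖ - κ⁻¹ * ‖f' x‖) ^ 2 := by positivity
    have h7 : κ * (‖f x‖ - κ⁻¹ * ‖f' x‖) ^ 2 =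
        κ * ‖f x‖ ^ 2 + κ⁻¹ * ‖f' x‖ ^ 2 - 2 * (‖f x‖ * ‖f' x‖) := by field_simp; ring
    linarith
  have h8 : 2 * κ * (‖f x‖ ^ 2 + (κ ^ 2)⁻¹ * ‖f' x‖ ^ 2) =
      2 * κ * ‖f x‖ ^ 2 + 2 * (κ⁻¹ * ‖f' x‖ ^ 2) := by field_simp
  have h9 : 1 / (b - a) * ‖f x‖ ^ 2 ≤ κ * ‖f x‖ ^ 2 := by gcongr
  have h10 : 0 ≤ κ⁻¹ * ‖f' x‖ ^ 2 := by positivity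
  linarith

section Rectangle

variable {g : ℝ × ℝ → ℂ} {a b c d κ : ℝ}

theorem continuousOn_of_analyticAt {s : Set (ℝ × ℝ)} (hg : ∀ p ∈ s, AnalyticAt ℝ g p) :
    ContinuousOn g s :=
  fun p hp => (hg p hp).continuousAt.continuousWithinAt

theorem integrableOn_Ioo_prod_norm_sq
    (hg : ∀ p ∈ Set.Icc a b ×ˢ Set.Icc c d, AnalyticAt ℝ g p) :
    IntegrableOn (fun p => ‖g p‖ ^ 2) (Set.Ioo a b ×ˢ Set.Ioo c d) := by
  have h := continuousOn_of_analyticAt hg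
  have h2 : ContinuousOn (fun p => ‖g p‖ ^ 2) (Set.Icc a b ×ˢ Set.Icc c d) := by fun_prop
  exact (h2.integrableOn_compact (isCompact_Icc.prod isCompact_Icc)).mono_set
    (Set.prod_mono Set.Ioo_subset_Icc_self Set.Ioo_subset_Icc_self)

/-- The endpoint inequality on each vertical line, integrated in `x` by Fubini. -/
theorem integral_horizontal_trace_le (hκ : 0 < κ) (hcd : 1 ≤ κ * (d - c))
    (hg : ∀ p ∈ Set.Icc a b ×ˢ Set.Icc c d, AnalyticAt ℝ g p) {e : ℝ} (he : e = c ∨ e = d) :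
    ∫ x in Set.Ioo a b, ‖g (x, e)‖ ^ 2 ≤
      2 * κ * ((∫ p in Set.Ioo a b ×ˢ Set.Ioo c d, ‖g p‖ ^ 2) +
        (κ ^ 2)⁻¹ * ∫ p in Set.Ioo a b ×ˢ Set.Ioo c d, ‖pd2 g p‖ ^ 2) := by
  have hlt : c ≤ d := by nlinarith
  have i1 := integrableOn_Ioo_prod_norm_sq hg
  have i2 := (integrableOn_Ioo_prod_norm_sq (g := pd2 g) fun p hp => (hg p hp).pd2).const_mul
    (κ ^ 2)⁻¹
  have i3 : IntegrableOn (fun p => ‖g p‖ ^ 2 + (κ ^ 2)⁻¹ * ‖pd2 g p‖ ^ 2)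
      (Set.Ioo a b ×ˢ Set.Ioo c d) := i1.add i2
  rw [← integral_const_mul, ← integral_add i1 i2, ← integral_const_mul]
  have hr : (volume : Measure (ℝ × ℝ)).restrict (Set.Ioo a b ×ˢ Set.Ioo c d) =
      (volume.restrict (Set.Ioo a b)).prod (volume.restrict (Set.Ioo c d)) := by
    rw [Measure.prod_restrict]; rfl
  have i4 := i3.const_mul (2 * κ)
  rw [hr] at i4 ⊢
  rw [integral_prod _ i4]
  have hec : e ∈ Set.Icc c d := by
    rcases he with rfl | rfl
    · exact ⟨le_rfl, hlt⟩
    · exact ⟨hlt, le_rfl⟩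
  refine setIntegral_mono_on ?_ i4.integral_prod_left measurableSet_Ioo fun x hx => ?_
  · have h1 : ContinuousOn (fun x => ‖g (x, e)‖ ^ 2) (Set.Icc a b) := by
      have := (continuousOn_of_analyticAt hg).comp (f := fun x : ℝ => (x, e)) (s := Set.Icc a b)
        (by fun_prop) (fun x hx => ⟨hx, hec⟩)
      exact this.norm.pow 2
    exact (h1.integrableOn_compact isCompact_Icc).mono_set Set.Ioo_subset_Icc_self
  · have hx' : x ∈ Set.Icc a b := Set.Ioo_subset_Icc_self hx
    refine (norm_sq_endpoint_le (f := fun y => g (x, y)) (f' := fun y => pd2 g (x, y)) hκ hcd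
      ?_ ?_ he).trans_eq (integral_const_mul _ _).symm
    · intro y hy
      have := hg (x, y) ⟨hx', hy⟩
      rw [pd2_eq_fderiv this]
      exact hasDerivAt_snd_of_differentiableAt this.differentiableAt
    · exact (continuousOn_of_analyticAt fun p hp => (hg p hp).pd2).comp (f := fun y : ℝ => (x, y))
        (s := Set.Icc c d) (by fun_prop) (fun y hy => ⟨hx', hy⟩)

theorem integral_vertical_trace_le (hκ : 0 < κ) (hab : 1 ≤ κ * (b - a))
    (hg : ∀ p ∈ Set.Icc a b ×ˢ Set.Icc c d, AnalyticAt ℝ g p) {e : ℝ} (he : e = a ∨ e = b) :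
    ∫ y in Set.Ioo c d, ‖g (e, y)‖ ^ 2 ≤
      2 * κ * ((∫ p in Set.Ioo a b ×ˢ Set.Ioo c d, ‖g p‖ ^ 2) +
        (κ ^ 2)⁻¹ * ∫ p in Set.Ioo a b ×ˢ Set.Ioo c d, ‖pd1 g p‖ ^ 2) := by
  have hlt : a ≤ b := by nlinarith
  have i1 := integrableOn_Ioo_prod_norm_sq hg
  have i2 := (integrableOn_Ioo_prod_norm_sq (g := pd1 g) fun p hp => (hg p hp).pd1).const_mul
    (κ ^ 2)⁻¹
  have i3 : IntegrableOn (fun p => ‖g p‖ ^ 2 + (κ ^ 2)⁻¹ * ‖pd1 g p‖ ^ 2)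
      (Set.Ioo a b ×ˢ Set.Ioo c d) := i1.add i2
  rw [← integral_const_mul, ← integral_add i1 i2, ← integral_const_mul]
  have hr : (volume : Measure (ℝ × ℝ)).restrict (Set.Ioo a b ×ˢ Set.Ioo c d) =
      (volume.restrict (Set.Ioo a b)).prod (volume.restrict (Set.Ioo c d)) := by
    rw [Measure.prod_restrict]; rfl
  have i4 := i3.const_mul (2 * κ)
  rw [hr] at i4 ⊢
  rw [integral_prod_symm _ i4]
  have hec : e ∈ Set.Icc a b := by
    rcases he with rfl | rfl
    · exact ⟨le_rfl, hlt⟩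
    · exact ⟨hlt, le_rfl⟩
  refine setIntegral_mono_on ?_ i4.integral_prod_right measurableSet_Ioo fun y hy => ?_
  · have h1 : ContinuousOn (fun y => ‖g (e, y)‖ ^ 2) (Set.Icc c d) := by
      have := (continuousOn_of_analyticAt hg).comp (f := fun y : ℝ => (e, y)) (s := Set.Icc c d)
        (by fun_prop) (fun y hy => ⟨hec, hy⟩)
      exact this.norm.pow 2
    exact (h1.integrableOn_compact isCompact_Icc).mono_set Set.Ioo_subset_Icc_self
  · have hy' : y ∈ Set.Icc c d := Set.Ioo_subset_Icc_self hy
    refine (norm_sq_endpoint_le (f := fun x => g (x, y)) (f' := fun x => pd1 g (x, y)) hκ hab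
      ?_ ?_ he).trans_eq (integral_const_mul _ _).symm
    · intro x hx
      have := hg (x, y) ⟨hx, hy'⟩
      rw [pd1_eq_fderiv this]
      exact hasDerivAt_fst_of_differentiableAt this.differentiableAt
    · exact (continuousOn_of_analyticAt fun p hp => (hg p hp).pd1).comp (f := fun x : ℝ => (x, y))
        (s := Set.Icc a b) (by fun_prop) (fun x hx => ⟨hx, hy'⟩)

/-- The endpoint inequality along the side through the corner, followed by the side trace inequality
for `g` and for `∂₁g`. Each direction costs one derivative. -/
theorem norm_sq_corner_le (hκ : 0 < κ) (hab : 1 ≤ κ * (b - a)) (hcd : 1 ≤ κ * (d - c))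
    (hg : ∀ p ∈ Set.Icc a b ×ˢ Set.Icc c d, AnalyticAt ℝ g p) {e f : ℝ} (he : e = a ∨ e = b)
    (hf : f = c ∨ f = d) :
    ‖g (e, f)‖ ^ 2 ≤
      4 * κ ^ 2 * ((∫ p in Set.Ioo a b ×ˢ Set.Ioo c d, ‖g p‖ ^ 2) +
        (κ ^ 2)⁻¹ * (∫ p in Set.Ioo a b ×ˢ Set.Ioo c d, ‖pd2 g p‖ ^ 2) +
        (κ ^ 2)⁻¹ * ((∫ p in Set.Ioo a b ×ˢ Set.Ioo c d, ‖pd1 g p‖ ^ 2) +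
        (κ ^ 2)⁻¹ * ∫ p in Set.Ioo a b ×ˢ Set.Ioo c d, ‖pd2 (pd1 g) p‖ ^ 2)) := by
  have hlt : c ≤ d := by nlinarith
  have hfc : f ∈ Set.Icc c d := by
    rcases hf with rfl | rfl
    · exact ⟨le_rfl, hlt⟩
    · exact ⟨hlt, le_rfl⟩
  have hg1 : ∀ p ∈ Set.Icc a b ×ˢ Set.Icc c d, AnalyticAt ℝ (pd1 g) p := fun p hp => (hg p hp).pd1
  have cont : ∀ {w : ℝ × ℝ → ℂ}, (∀ p ∈ Set.Icc a b ×ˢ Set.Icc c d, AnalyticAt ℝ w p) →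
      ContinuousOn (fun x => w (x, f)) (Set.Icc a b) := fun hw =>
    (continuousOn_of_analyticAt hw).comp (f := fun x : ℝ => (x, f)) (s := Set.Icc a b)
      (by fun_prop) (fun x hx => ⟨hx, hfc⟩)
  have int : ∀ {w : ℝ × ℝ → ℂ}, (∀ p ∈ Set.Icc a b ×ˢ Set.Icc c d, AnalyticAt ℝ w p) →
      IntegrableOn (fun x => ‖w (x, f)‖ ^ 2) (Set.Ioo a b) := fun hw =>
    (((cont hw).norm.pow 2).integrableOn_compact isCompact_Icc).mono_set Set.Ioo_subset_Icc_self
  have h1 := norm_sq_endpoint_le (f := fun x => g (x, f)) (f' := fun x => pd1 g (x, f)) hκ hab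
    (fun x hx => by
      have := hg (x, f) ⟨hx, hfc⟩
      rw [pd1_eq_fderiv this]
      exact hasDerivAt_fst_of_differentiableAt this.differentiableAt) (cont hg1) he
  rw [integral_add (int hg) ((int hg1).const_mul _), integral_const_mul] at h1
  have h2 := integral_horizontal_trace_le hκ hcd hg hf
  have h3 := integral_horizontal_trace_le hκ hcd hg1 hf
  have hk : 0 < (κ ^ 2)⁻¹ := by positivity
  have h4 := add_le_add h2 (mul_le_mul_of_nonneg_left h3 hk.le)
  refine h1.trans ((mul_le_mul_of_nonneg_left h4 (by positivity : 0 ≤ 2 * κ)).trans_eq ?_)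
  ring

end Rectangle

namespace Mesh

variable (T : Mesh)

/-! ### The weighted Sobolev norm controls traces and nodal values -/

theorem closure_cell (c : ℤ × ℤ) :
    closure (T.cell c) = Set.Icc (T.pt c).1 ((T.pt c).1 + T.h₁) ×ˢ
      Set.Icc (T.pt c).2 ((T.pt c).2 + T.h₂) := by
  have h1 := T.h₁_pos
  have h2 := T.h₂_pos
  rw [cell, closure_prod_eq, closure_Ioo (by linarith), closure_Ioo (by linarith)]

theorem isOpen_cell (c : ℤ × ℤ) : IsOpen (T.cell c) := isOpen_Ioo.prod isOpen_Ioo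

theorem cell_subset_domain {c : ℤ × ℤ} (hc : c ∈ T.cells) : T.cell c ⊆ T.domain :=
  interior_maximal (subset_closure.trans (Set.subset_biUnion_of_mem (u := fun c =>
    closure (T.cell c)) hc)) (T.isOpen_cell c)

theorem isCompact_closure_domain : IsCompact (closure T.domain) := by
  have h : IsCompact (⋃ c ∈ T.cells, closure (T.cell c)) := by
    refine T.cells.isCompact_biUnion fun c _ => ?_
    rw [closure_cell]
    exact isCompact_Icc.prod isCompact_Icc
  exact h.of_isClosed_subset isClosed_closure (closure_minimal interior_subset h.isClosed)

variable {T} {κ : ℝ} {M : ℕ} {u : ℝ × ℝ → ℂ}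

theorem integral_cell_le_sobolevNorm (hκ : 0 < κ) (hu : AnalyticOnNhd ℝ u (closure T.domain))
    {c : ℤ × ℤ} (hc : c ∈ T.cells) {i j : ℕ} (hij : i + j ≤ M) :
    (κ ^ (2 * (i + j)))⁻¹ * ∫ p in T.cell c, ‖(pd1^[i] (pd2^[j] u)) p‖ ^ 2 ≤
      sobolevNorm κ M T.domain u ^ 2 := by
  set F : ℕ → ℕ × ℕ → ℝ := fun k a =>
    (κ ^ (2 * k))⁻¹ * ∫ p in T.domain, ‖(pd1^[a.1] (pd2^[a.2] u)) p‖ ^ 2 with hF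
  have hnn : ∀ k a, 0 ≤ F k a :=
    fun k a => mul_nonneg (by positivity) (integral_nonneg fun p => by positivity)
  have hS : sobolevNorm κ M T.domain u ^ 2 =
      ∑ k ∈ Finset.range (M + 1), ∑ a ∈ Finset.HasAntidiagonal.antidiagonal k, F k a :=
    Real.sq_sqrt (Finset.sum_nonneg fun k _ => Finset.sum_nonneg fun a _ => hnn k a)
  have han : ∀ p ∈ closure T.domain, AnalyticAt ℝ (pd1^[i] (pd2^[j] u)) p :=
    fun p hp => ((hu p hp).iterate_pd2 j).iterate_pd1 i
  -- Monotonicity of the integral in the set requires integrability on the larger one; it holds by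
  -- compactness of the closure.
  have hint : IntegrableOn (fun p => ‖(pd1^[i] (pd2^[j] u)) p‖ ^ 2) T.domain :=
    (((continuousOn_of_analyticAt han).norm.pow 2).integrableOn_compact
      T.isCompact_closure_domain).mono_set subset_closure
  have h1 : (κ ^ (2 * (i + j)))⁻¹ * ∫ p in T.cell c, ‖(pd1^[i] (pd2^[j] u)) p‖ ^ 2 ≤
      F (i + j) (i, j) := by
    refine mul_le_mul_of_nonneg_left ?_ (by positivity)
    exact setIntegral_mono_set hint (ae_of_all _ fun p => by positivity)
      (T.cell_subset_domain hc).eventuallyLE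
  have h2 : F (i + j) (i, j) ≤ ∑ a ∈ Finset.HasAntidiagonal.antidiagonal (i + j), F (i + j) a :=
    Finset.single_le_sum (fun a _ => hnn _ a) (Finset.HasAntidiagonal.mem_antidiagonal.2 rfl)
  have h3 : ∑ a ∈ Finset.HasAntidiagonal.antidiagonal (i + j), F (i + j) a ≤
      ∑ k ∈ Finset.range (M + 1), ∑ a ∈ Finset.HasAntidiagonal.antidiagonal k, F k a :=
    Finset.single_le_sum (f := fun k => ∑ a ∈ Finset.HasAntidiagonal.antidiagonal k, F k a)
      (fun k _ => Finset.sum_nonneg fun a _ => hnn k a) (Finset.mem_range.2 (by omega))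
  rw [hS]
  exact h1.trans (h2.trans h3)

theorem analyticAt_of_mem_cell (hu : AnalyticOnNhd ℝ u (closure T.domain))
    {c : ℤ × ℤ} (hc : c ∈ T.cells) :
    ∀ p ∈ Set.Icc (T.pt c).1 ((T.pt c).1 + T.h₁) ×ˢ Set.Icc (T.pt c).2 ((T.pt c).2 + T.h₂),
      AnalyticAt ℝ u p := fun p hp =>
  hu p (closure_mono (T.cell_subset_domain hc) (by rw [closure_cell]; exact hp))

/-- The corner estimate for `∂₁ᵏu` involves four norms of order at most `k + 2`, each bounded by the
full norm; `4κ²` times four gives `(4κ)²`. -/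
theorem norm_vertex_derivative_le (hκ : 0 < κ) (h1 : 1 ≤ κ * T.h₁) (h2 : 1 ≤ κ * T.h₂)
    (hu : AnalyticOnNhd ℝ u (closure T.domain)) {c : ℤ × ℤ} (hc : c ∈ T.cells) {q : ℤ × ℤ}
    (hq : q ∈ vertices c) {k : ℕ} (hk : k + 2 ≤ M) :
    ‖((κ : ℂ) ^ k)⁻¹ * (pd1^[k] u) (T.pt q)‖ ≤ 4 * κ * sobolevNorm κ M T.domain u := by
  have hS : 0 ≤ sobolevNorm κ M T.domain u := Real.sqrt_nonneg _
  have hu' := analyticAt_of_mem_cell hu hc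
  have hq1 : (T.pt q).1 = (T.pt c).1 ∨ (T.pt q).1 = (T.pt c).1 + T.h₁ := by
    simp only [vertices, Finset.mem_insert, Finset.mem_singleton] at hq
    rcases hq with rfl | rfl | rfl | rfl
    · exact Or.inl rfl
    · right; simp only [pt, Prod.fst_add]; push_cast; ring
    · left; simp [pt]
    · right; simp only [pt, Prod.fst_add]; push_cast; ring
  have hq2 : (T.pt q).2 = (T.pt c).2 ∨ (T.pt q).2 = (T.pt c).2 + T.h₂ := by
    simp only [vertices, Finset.mem_insert, Finset.mem_singleton] at hq
    rcases hq with rfl | rfl | rfl | rfl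
    · exact Or.inl rfl
    · left; simp [pt]
    · right; simp only [pt, Prod.snd_add]; push_cast; ring
    · right; simp only [pt, Prod.snd_add]; push_cast; ring
  have key := norm_sq_corner_le (g := pd1^[k] u) hκ (by simpa using h1) (by simpa using h2)
    (fun p hp => (hu' p hp).iterate_pd1 k) hq1 hq2
  have a0 := integral_cell_le_sobolevNorm (M := M) (i := k) (j := 0) hκ hu hc (by omega)
  have a1 := integral_cell_le_sobolevNorm (M := M) (i := k + 1) (j := 0) hκ hu hc (by omega)
  have a2 := integral_cell_le_sobolevNorm (M := M) (i := k) (j := 1) hκ hu hc (by omega)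
  have a3 := integral_cell_le_sobolevNorm (M := M) (i := k + 1) (j := 1) hκ hu hc (by omega)
  have e2 : ∀ k, ∫ p in T.cell c, ‖pd2 (pd1^[k] u) p‖ ^ 2 =
      ∫ p in T.cell c, ‖(pd1^[k] (pd2 u)) p‖ ^ 2 := fun k => by
    refine setIntegral_congr_fun (T.isOpen_cell c).measurableSet fun p hp => ?_
    rw [pd2_iterate_pd1 k (hu' p (by rw [← closure_cell]; exact subset_closure hp))]
  simp only [Function.iterate_zero, id, Function.iterate_one, add_zero] at a0 a1 a2 a3
  rw [← e2] at a2 a3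
  rw [Function.iterate_succ_apply'] at a1 a3
  rw [← cell] at key
  set S := sobolevNorm κ M T.domain u
  set A0 := ∫ p in T.cell c, ‖(pd1^[k] u) p‖ ^ 2
  set A1 := ∫ p in T.cell c, ‖pd1 (pd1^[k] u) p‖ ^ 2
  set A2 := ∫ p in T.cell c, ‖pd2 (pd1^[k] u) p‖ ^ 2
  set A3 := ∫ p in T.cell c, ‖pd2 (pd1 (pd1^[k] u)) p‖ ^ 2
  refine le_of_sq_le_sq ?_ (by positivity)
  rw [norm_mul, mul_pow, norm_inv, norm_pow, Complex.norm_real, Real.norm_of_nonneg hκ.le]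
  have hkk : 0 < ((κ ^ k)⁻¹) ^ 2 := by positivity
  calc _ ≤ ((κ ^ k)⁻¹) ^ 2 * _ := mul_le_mul_of_nonneg_left key hkk.le
    _ = 4 * κ ^ 2 * ((κ ^ (2 * k))⁻¹ * A0 + (κ ^ (2 * (k + 1)))⁻¹ * A2 +
        (κ ^ (2 * (k + 1)))⁻¹ * A1 + (κ ^ (2 * (k + 1 + 1)))⁻¹ * A3) := by
      field_simp; ring
    _ ≤ 4 * κ ^ 2 * (S ^ 2 + S ^ 2 + S ^ 2 + S ^ 2) := by gcongr
    _ = _ := by ring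

end Mesh

/-! ### The evanescent or propagating factor of a mode -/

open scoped ComplexOrder in
theorem modeRoot_of_nonneg {κ a : ℝ} {n : ℕ} (h : 0 ≤ 1 - nuHat κ a n ^ 2) :
    modeRoot κ a n = (√(1 - nuHat κ a n ^ 2) : ℝ) := by
  rw [modeRoot, Complex.sqrt_of_nonneg (by exact_mod_cast h), Complex.ofReal_re]

open scoped ComplexOrder in
theorem modeRoot_of_nonpos {κ a : ℝ} {n : ℕ} (h : 1 - nuHat κ a n ^ 2 ≤ 0) :
    modeRoot κ a n = Complex.I * (√(nuHat κ a n ^ 2 - 1) : ℝ) := by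
  have e : ((1 - nuHat κ a n ^ 2 : ℝ) : ℂ) = -((nuHat κ a n ^ 2 - 1 : ℝ) : ℂ) := by
    push_cast; ring
  have h' : (0 : ℝ) ≤ nuHat κ a n ^ 2 - 1 := by linarith
  have h'' : (0 : ℂ) ≤ ((nuHat κ a n ^ 2 - 1 : ℝ) : ℂ) := by exact_mod_cast h'
  rw [modeRoot, e, Complex.sqrt_neg_of_nonneg h'', Complex.sqrt_of_nonneg h'', Complex.ofReal_re]

theorem sin_mul_modeRoot_of_nonneg {κ a : ℝ} {n : ℕ} (h : 0 ≤ 1 - nuHat κ a n ^ 2) (t : ℝ) :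
    Complex.sin (t * κ * modeRoot κ a n) = (Real.sin (t * κ * √(1 - nuHat κ a n ^ 2)) : ℝ) := by
  rw [modeRoot_of_nonneg h]; push_cast; rfl

theorem sin_mul_modeRoot_of_nonpos {κ a : ℝ} {n : ℕ} (h : 1 - nuHat κ a n ^ 2 ≤ 0) (t : ℝ) :
    Complex.sin (t * κ * modeRoot κ a n) =
      (Real.sinh (t * κ * √(nuHat κ a n ^ 2 - 1)) : ℝ) * Complex.I := by
  rw [modeRoot_of_nonpos h, show (t : ℂ) * κ * (Complex.I * (√(nuHat κ a n ^ 2 - 1) : ℝ)) =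
    ((t * κ * √(nuHat κ a n ^ 2 - 1) : ℝ) : ℂ) * Complex.I by push_cast; ring,
    Complex.sin_mul_I, ← Complex.ofReal_sinh]

/-- For `ν ≤ 1` a zero of the sine says that `κ²` is one of the excluded values, the cut-off `ν = 1`
being the case `m = 0`. For `ν > 1` the denominator is `i sinh` of a positive number. -/
theorem sin_mul_modeRoot_ne_zero {κ a b : ℝ} (hκ : 0 < κ) (ha : 0 < a) (hb : 0 < b) {n : ℕ}
    (h : ∀ m : ℕ, κ ^ 2 ≠ (n * Real.pi / a) ^ 2 + (m * Real.pi / b) ^ 2) :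
    Complex.sin (b * κ * modeRoot κ a n) ≠ 0 := by
  have hν : κ * nuHat κ a n = n * Real.pi / a := by rw [nuHat]; field_simp
  rcases le_or_gt 0 (1 - nuHat κ a n ^ 2) with h0 | h0
  · rw [sin_mul_modeRoot_of_nonneg h0, Complex.ofReal_ne_zero]
    intro hs
    obtain ⟨k, hk⟩ := Real.sin_eq_zero_iff.1 hs
    refine h k.natAbs ?_
    have h1 : ((k.natAbs : ℝ)) ^ 2 = (k : ℝ) ^ 2 := by
      rw [Nat.cast_natAbs, Int.cast_abs, sq_abs]
    have h2 : ((k : ℝ) * Real.pi) ^ 2 = b ^ 2 * (κ ^ 2 - (κ * nuHat κ a n) ^ 2) := by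
      rw [hk, mul_pow, Real.sq_sqrt h0]; ring
    rw [hν] at h2
    rw [div_pow (k.natAbs * Real.pi), mul_pow (k.natAbs : ℝ), h1, ← mul_pow, h2]
    field_simp
    ring
  · rw [sin_mul_modeRoot_of_nonpos h0.le]
    refine mul_ne_zero (Complex.ofReal_ne_zero.2 ?_) Complex.I_ne_zero
    have : 0 < √(nuHat κ a n ^ 2 - 1) := Real.sqrt_pos.2 (by linarith)
    exact (Real.sinh_pos_iff.2 (by positivity)).ne'

/-- The factor of a reference mode in the direction away from its edge. -/
def modeRatio (κ a b : ℝ) (n : ℕ) (t : ℝ) : ℂ :=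
  Complex.sin (t * κ * modeRoot κ a n) / Complex.sin (b * κ * modeRoot κ a n)

theorem modeRatio_zero (κ a b : ℝ) (n : ℕ) : modeRatio κ a b n 0 = 0 := by simp [modeRatio]

theorem continuous_modeRatio (κ a b : ℝ) (n : ℕ) : Continuous (modeRatio κ a b n) := by
  unfold modeRatio
  fun_prop

/-- An evanescent ratio is a quotient of increasing `sinh` values, hence at most `1`; a propagating
one is at most the inverse of its denominator. At the cut-off the quotient is `0 / 0 = 0`, so that
case joins the evanescent one. -/
theorem norm_modeRatio_le {κ a b M : ℝ} (hκ : 0 < κ) (hb : 0 < b) {n : ℕ} (hM : 1 ≤ M)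
    (h : 0 < 1 - nuHat κ a n ^ 2 → 1 ≤ M * |Real.sin (b * κ * √(1 - nuHat κ a n ^ 2))|)
    {t : ℝ} (ht : t ∈ Set.Icc 0 b) : ‖modeRatio κ a b n t‖ ≤ M := by
  have hM0 : 0 ≤ M := by linarith
  rw [modeRatio, norm_div]
  refine div_le_of_le_mul₀ (norm_nonneg _) hM0 ?_
  rcases lt_or_ge 0 (1 - nuHat κ a n ^ 2) with h0 | h0
  · rw [sin_mul_modeRoot_of_nonneg h0.le, sin_mul_modeRoot_of_nonneg h0.le, Complex.norm_real,
      Complex.norm_real, Real.norm_eq_abs, Real.norm_eq_abs]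
    exact (Real.abs_sin_le_one _).trans (h h0)
  · rw [sin_mul_modeRoot_of_nonpos h0, sin_mul_modeRoot_of_nonpos h0, norm_mul, norm_mul,
      Complex.norm_real, Complex.norm_real, Complex.norm_I, mul_one, mul_one, Real.norm_eq_abs,
      Real.norm_eq_abs]
    have hs := Real.sqrt_nonneg (nuHat κ a n ^ 2 - 1)
    rw [abs_of_nonneg (Real.sinh_nonneg_iff.2 (by have := ht.1; positivity)),
      abs_of_nonneg (Real.sinh_nonneg_iff.2 (by positivity))]
    have h1 : Real.sinh (t * κ * √(nuHat κ a n ^ 2 - 1)) ≤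
        Real.sinh (b * κ * √(nuHat κ a n ^ 2 - 1)) :=
      Real.sinh_le_sinh.2 (by have := ht.2; gcongr)
    exact h1.trans (le_mul_of_one_le_left (Real.sinh_nonneg_iff.2 (by positivity)) hM)

/-! ### Iterated derivatives of separated functions -/

theorem iterate_pd1_mul (f g : ℝ → ℂ) (k : ℕ) :
    pd1^[k] (fun p => f p.1 * g p.2) = fun p => (deriv^[k] f) p.1 * g p.2 := by
  induction k with
  | zero => rfl
  | succ k ih =>
    rw [Function.iterate_succ_apply', ih, Function.iterate_succ_apply']
    funext p
    simp only [pd1, deriv_mul_const_field]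

theorem eqOn_iterate_deriv {f g : ℝ → ℂ} {I : Set ℝ} (hI : IsOpen I) (h : Set.EqOn f g I) (k : ℕ) :
    Set.EqOn (deriv^[k] f) (deriv^[k] g) I := by
  induction k with
  | zero => exact h
  | succ k ih =>
    intro x hx
    rw [Function.iterate_succ_apply', Function.iterate_succ_apply']
    exact (ih.eventuallyEq_of_mem (hI.mem_nhds hx)).deriv_eq

theorem iterate_deriv_sin (ω s c : ℝ) (n : ℕ) :
    deriv^[2 * n] (fun x => ((c * Real.sin (ω * (x - s)) : ℝ) : ℂ)) =
      fun x => (-(ω : ℂ) ^ 2) ^ n * ((c * Real.sin (ω * (x - s)) : ℝ) : ℂ) := by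
  have hl : ∀ x, HasDerivAt (fun x => ω * (x - s)) ω x := fun x => by
    simpa using ((hasDerivAt_id x).sub_const s).const_mul ω
  have d1 : deriv (fun x => ((c * Real.sin (ω * (x - s)) : ℝ) : ℂ)) =
      fun x => ((c * (Real.cos (ω * (x - s)) * ω) : ℝ) : ℂ) := by
    funext x
    exact ((hl x).sin.const_mul c).ofReal_comp.deriv
  have d2 : deriv (fun x => ((c * (Real.cos (ω * (x - s)) * ω) : ℝ) : ℂ)) =
      fun x => -(ω : ℂ) ^ 2 * ((c * Real.sin (ω * (x - s)) : ℝ) : ℂ) := by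
    funext x
    rw [(((hl x).cos.mul_const ω).const_mul c).ofReal_comp.deriv]
    push_cast; ring
  induction n with
  | zero => simp
  | succ n ih =>
    rw [show 2 * (n + 1) = 2 * n + 1 + 1 by ring, Function.iterate_succ_apply',
      Function.iterate_succ_apply', ih]
    have d3 : deriv (fun x => (-(ω : ℂ) ^ 2) ^ n * ((c * Real.sin (ω * (x - s)) : ℝ) : ℂ)) =
        fun x => (-(ω : ℂ) ^ 2) ^ n * ((c * (Real.cos (ω * (x - s)) * ω) : ℝ) : ℂ) := by
      funext x
      rw [deriv_const_mul_field, d1]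
    rw [d3]
    funext x
    rw [deriv_const_mul_field, d2]
    ring

namespace Mesh

variable (T : Mesh)

/-! ### The node functions as tensor products -/

/-- Horizontal profile of the `m`-th node function (counted from zero) of a node in column `i`. -/
def hProfile (i : ℤ) (m : ℕ) (x : ℝ) : ℝ :=
  Real.sin ((2 * m + 1) * Real.pi / (2 * T.h₁) *
    max 0 (min (2 * T.h₁) (T.h₁ + (x - (T.x₀ + i * T.h₁)))))

/-- Vertical profile of the `m`-th node function (counted from zero) of a node in row `j`. -/
def vProfile (κ : ℝ) (j : ℤ) (m : ℕ) (y : ℝ) : ℂ :=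
  modeRatio κ (2 * T.h₁) T.h₂ (2 * m + 1) (max 0 (T.h₂ - |y - (T.y₀ + j * T.h₂)|))

theorem continuous_hProfile (i : ℤ) (m : ℕ) : Continuous (T.hProfile i m) := by
  unfold hProfile; fun_prop

theorem continuous_vProfile (κ : ℝ) (j : ℤ) (m : ℕ) : Continuous (T.vProfile κ j m) :=
  (continuous_modeRatio _ _ _ _).comp (by fun_prop)

theorem abs_hProfile_le (i : ℤ) (m : ℕ) (x : ℝ) : |T.hProfile i m x| ≤ 1 := Real.abs_sin_le_one _

theorem hProfile_of_le {i : ℤ} {m : ℕ} {x : ℝ} (h : |x - (T.x₀ + i * T.h₁)| ≤ T.h₁) :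
    T.hProfile i m x =
      Real.sin ((2 * m + 1) * Real.pi / (2 * T.h₁) * (T.h₁ + (x - (T.x₀ + i * T.h₁)))) := by
  have := abs_le.1 h
  rw [hProfile, min_eq_right (by linarith), max_eq_right (by linarith)]

theorem hProfile_eq_zero {i : ℤ} {m : ℕ} {x : ℝ} (h : T.h₁ ≤ |x - (T.x₀ + i * T.h₁)|) :
    T.hProfile i m x = 0 := by
  have h1 := T.h₁_pos
  rcases le_abs.1 h with h | h
  · rw [hProfile, min_eq_left (by linarith), max_eq_right (by linarith)]
    rw [div_mul_cancel₀ _ (by positivity)]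
    exact_mod_cast Real.sin_nat_mul_pi (2 * m + 1)
  · rw [hProfile, max_eq_left ((min_le_right _ _).trans (by linarith))]
    simp

theorem vProfile_of_le {κ : ℝ} {j : ℤ} {m : ℕ} {y : ℝ} (h : |y - (T.y₀ + j * T.h₂)| ≤ T.h₂) :
    T.vProfile κ j m y =
      modeRatio κ (2 * T.h₁) T.h₂ (2 * m + 1) (T.h₂ - |y - (T.y₀ + j * T.h₂)|) := by
  rw [vProfile, max_eq_right (by linarith)]

theorem vProfile_eq_zero {κ : ℝ} {j : ℤ} {m : ℕ} {y : ℝ} (h : T.h₂ ≤ |y - (T.y₀ + j * T.h₂)|) :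
    T.vProfile κ j m y = 0 := by
  rw [vProfile, max_eq_left (by linarith), modeRatio_zero]

/-- Clamping the profile arguments reproduces the extension by zero, because the sine vanishes at
both ends of the coarse cell and `modeRatio` vanishes at `0`. The node functions are therefore
globally continuous tensor products. -/
theorem nodeBasis_eq {κ : ℝ} (hκ : 0 < κ) (q : ℤ × ℤ) (m : ℕ) (p : ℝ × ℝ) :
    T.nodeBasis κ q (m + 1) p = (T.hProfile q.1 m p.1 : ℂ) * T.vProfile κ q.2 m p.2 := by
  have h1 := T.h₁_pos
  have h2 := T.h₂_pos
  have hω : κ * nuHat κ (2 * T.h₁) (2 * m + 1) = (2 * m + 1) * Real.pi / (2 * T.h₁) := by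
    rw [nuHat]; push_cast; field_simp
  have hn : 2 * (m + 1) - 1 = 2 * m + 1 := by omega
  simp only [nodeBasis, hn, phiHat, hω, Set.mem_prod, Set.mem_Icc, pt]
  split_ifs with ha hb
  · obtain ⟨⟨a1, a2⟩, a3, a4⟩ := ha
    have hy : |p.2 - (T.y₀ + q.2 * T.h₂)| = p.2 - (T.y₀ + q.2 * T.h₂) :=
      abs_of_nonneg (by linarith)
    rw [T.hProfile_of_le (abs_le.2 ⟨by linarith, by linarith⟩),
      T.vProfile_of_le (by rw [hy]; linarith), hy, modeRatio]
    congr 3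
    · congr 2; ring
    · congr 3; ring
  · obtain ⟨⟨a1, a2⟩, a3, a4⟩ := hb
    have hy : |p.2 - (T.y₀ + q.2 * T.h₂)| = -(p.2 - (T.y₀ + q.2 * T.h₂)) :=
      abs_of_nonpos (by linarith)
    rw [T.hProfile_of_le (abs_le.2 ⟨by linarith, by linarith⟩),
      T.vProfile_of_le (by rw [hy]; linarith), hy, modeRatio]
    congr 3
    · congr 2; ring
    · congr 3; ring
  · by_cases hx : T.h₁ ≤ |p.1 - (T.x₀ + q.1 * T.h₁)|
    · rw [T.hProfile_eq_zero hx]; simp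
    · by_cases hy : T.h₂ ≤ |p.2 - (T.y₀ + q.2 * T.h₂)|
      · rw [T.vProfile_eq_zero hy]; simp
      · have hx' := abs_le.1 (not_le.1 hx).le
        have hy' := abs_le.1 (not_le.1 hy).le
        exfalso
        rcases le_total (T.y₀ + q.2 * T.h₂) p.2 with h | h
        · exact ha ⟨⟨by linarith, by linarith⟩, by linarith, by linarith⟩
        · exact hb ⟨⟨by linarith, by linarith⟩, by linarith, by linarith⟩

theorem le_abs_grid_sub {h : ℝ} (hh : 0 < h) (x₀ : ℝ) {i k : ℤ} (hik : k ≠ i) :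
    h ≤ |x₀ + k * h - (x₀ + i * h)| := by
  have h1 : (1 : ℝ) ≤ |((k - i : ℤ) : ℝ)| := by
    rw [← Int.cast_abs]
    exact_mod_cast Int.one_le_abs (sub_ne_zero.2 hik)
  have h2 : x₀ + k * h - (x₀ + i * h) = ((k - i : ℤ) : ℝ) * h := by push_cast; ring
  rw [h2, abs_mul, abs_of_pos hh]
  nlinarith

theorem le_abs_sub_of_mem_Icc {h : ℝ} (hh : 0 < h) {x₀ x : ℝ} {i k : ℤ} (h1 : i ≠ k)
    (h2 : i ≠ k + 1) (hx : x ∈ Set.Icc (x₀ + k * h) (x₀ + k * h + h)) :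
    h ≤ |x - (x₀ + i * h)| := by
  rcases lt_or_gt_of_ne h1 with h3 | h3
  · have : (i : ℝ) + 1 ≤ k := by exact_mod_cast h3
    exact le_abs.2 (Or.inl (by nlinarith [hx.1]))
  · have : (k : ℝ) + 2 ≤ i := by
      have : k + 2 ≤ i := by omega
      exact_mod_cast this
    exact le_abs.2 (Or.inr (by nlinarith [hx.2]))

theorem abs_sub_le_of_mem_Icc {h : ℝ} {x₀ x : ℝ} {i k : ℤ} (h1 : i = k ∨ i = k + 1)
    (hx : x ∈ Set.Icc (x₀ + k * h) (x₀ + k * h + h)) : |x - (x₀ + i * h)| ≤ h := by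
  rcases h1 with rfl | rfl
  · exact abs_le.2 ⟨by linarith [hx.1, hx.2], by linarith [hx.1, hx.2]⟩
  · push_cast
    exact abs_le.2 ⟨by linarith [hx.1, hx.2], by linarith [hx.1, hx.2]⟩

theorem hProfile_grid (i k : ℤ) (m : ℕ) :
    T.hProfile i m (T.x₀ + k * T.h₁) = if k = i then (-1) ^ m else 0 := by
  have h1 := T.h₁_pos
  split_ifs with h
  · subst h
    rw [T.hProfile_of_le (by simp [h1.le]), sub_self, add_zero,
      show (2 * (m : ℝ) + 1) * Real.pi / (2 * T.h₁) * T.h₁ = m * Real.pi + Real.pi / 2 by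
        field_simp,
      Real.sin_add_pi_div_two, Real.cos_nat_mul_pi]
  · exact T.hProfile_eq_zero (le_abs_grid_sub h1 _ h)

theorem vProfile_grid {κ : ℝ} {m : ℕ}
    (h0 : Complex.sin (T.h₂ * κ * modeRoot κ (2 * T.h₁) (2 * m + 1)) ≠ 0) (j k : ℤ) :
    T.vProfile κ j m (T.y₀ + k * T.h₂) = if k = j then 1 else 0 := by
  have h2 := T.h₂_pos
  split_ifs with h
  · subst h
    rw [T.vProfile_of_le (by simp [h2.le]), sub_self, abs_zero, sub_zero, modeRatio, div_self h0]
  · exact T.vProfile_eq_zero (le_abs_grid_sub h2 _ h)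

/-- On an open grid column the profile is a single sine of amplitude `1` or `0`. Its even
derivatives are thus multiples of the continuous profile itself, which is why their limits at a node
agree from all cells. -/
theorem iterate_deriv_hProfile (i k : ℤ) (m n : ℕ) {x : ℝ}
    (hx : x ∈ Set.Ioo (T.x₀ + k * T.h₁) (T.x₀ + k * T.h₁ + T.h₁)) :
    (deriv^[2 * n] fun x => (T.hProfile i m x : ℂ)) x =
      (-(((2 * m + 1) * Real.pi / (2 * T.h₁) : ℝ) : ℂ) ^ 2) ^ n * T.hProfile i m x := by
  have h1 := T.h₁_pos
  set ω : ℝ := (2 * m + 1) * Real.pi / (2 * T.h₁) with hω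
  obtain ⟨c, hc⟩ : ∃ c : ℝ, Set.EqOn (fun x => (T.hProfile i m x : ℂ))
      (fun x => ((c * Real.sin (ω * (x - (T.x₀ + i * T.h₁ - T.h₁))) : ℝ) : ℂ))
      (Set.Ioo (T.x₀ + k * T.h₁) (T.x₀ + k * T.h₁ + T.h₁)) := by
    by_cases h : i = k ∨ i = k + 1
    · refine ⟨1, fun y hy => ?_⟩
      simp only
      rw [T.hProfile_of_le (abs_sub_le_of_mem_Icc h (Set.Ioo_subset_Icc_self hy)), one_mul]
      congr 2
      rw [hω]; ring
    · push Not at h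
      refine ⟨0, fun y hy => ?_⟩
      simp only
      rw [T.hProfile_eq_zero (le_abs_sub_of_mem_Icc h1 h.1 h.2 (Set.Ioo_subset_Icc_self hy)),
        zero_mul]
  rw [eqOn_iterate_deriv isOpen_Ioo hc _ hx, iterate_deriv_sin]
  have := hc hx
  simp only at this ⊢
  rw [this]

/-! ### The collocation system -/

theorem mem_nodes_iff {q : ℤ × ℤ} : q ∈ T.nodes ↔ ∃ c ∈ T.cells, q ∈ vertices c :=
  Finset.mem_biUnion

theorem pt_mem_closure_cell {c q : ℤ × ℤ} (hq : q ∈ vertices c) :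
    T.pt q ∈ closure (T.cell c) := by
  have h1 := T.h₁_pos
  have h2 := T.h₂_pos
  rw [closure_cell]
  simp only [vertices, Finset.mem_insert, Finset.mem_singleton] at hq
  rcases hq with rfl | rfl | rfl | rfl <;>
    simp only [pt, Set.mem_prod, Set.mem_Icc, Prod.fst_add, Prod.snd_add, Int.cast_add,
      Int.cast_one, Int.cast_zero] <;>
    refine ⟨⟨?_, ?_⟩, ?_, ?_⟩ <;> linarith

/-- The decoupling: at a node, all products of profiles vanish except those of the node itself,
which equal `(-1)^m`. Each node thus carries its own Vandermonde system. -/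
theorem isCollocation_iff {κ : ℝ} (hκ : 0 < κ)
    (hs : ∀ m : ℕ, Complex.sin (T.h₂ * κ * modeRoot κ (2 * T.h₁) (2 * m + 1)) ≠ 0)
    (N : ℕ) (u : ℝ × ℝ → ℂ) (β : T.nodes → Fin N → ℂ) :
    T.IsCollocation κ N u β ↔ ∀ q : T.nodes, ∀ n < N,
      ∑ m : Fin N, β q m * ((-1) ^ (m : ℕ) *
        (-(((2 * (m : ℕ) + 1) * Real.pi / (2 * (κ * T.h₁))) ^ 2 : ℝ) : ℂ) ^ n) =
      ((κ : ℂ) ^ (2 * n))⁻¹ * (pd1^[2 * n] u) (T.pt q) := by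
  have hκ' : (κ : ℂ) ≠ 0 := Complex.ofReal_ne_zero.2 hκ.ne'
  have h1 := T.h₁_pos
  have h1' : (T.h₁ : ℂ) ≠ 0 := Complex.ofReal_ne_zero.2 h1.ne'
  set z : ℕ → ℂ := fun m => -(((2 * (m : ℕ) + 1) * Real.pi / (2 * (κ * T.h₁))) ^ 2 : ℝ) with hz
  have lim : ∀ n : ℕ, ∀ c q, ∀ hq : q ∈ T.nodes, q ∈ vertices c →
      Tendsto (fun x => ∑ p : T.nodes, ∑ m : Fin N,
        β p m * (((κ : ℂ) ^ (2 * n))⁻¹ * (pd1^[2 * n] (T.nodeBasis κ p (m + 1))) x))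
      (𝓝[T.cell c] (T.pt q))
      (𝓝 (∑ m : Fin N, β ⟨q, hq⟩ m * ((-1) ^ (m : ℕ) * z m ^ n))) := by
    intro n c q hq hqc
    -- `G` is continuous everywhere and agrees with the differentiated sum on each open cell, so the
    -- one-sided limit is `G` at the node.
    set G : ℝ × ℝ → ℂ := fun x => ∑ p : T.nodes, ∑ m : Fin N,
      β p m * (z m ^ n * (T.hProfile (p : ℤ × ℤ).1 m x.1 * T.vProfile κ (p : ℤ × ℤ).2 m x.2))
      with hG
    have hGc : Continuous G := by
      refine continuous_finsetSum _ fun p _ => continuous_finsetSum _ fun m _ => ?_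
      have c1 : Continuous fun x : ℝ × ℝ => T.hProfile (p : ℤ × ℤ).1 m x.1 :=
        (T.continuous_hProfile _ _).comp continuous_fst
      have c2 : Continuous fun x : ℝ × ℝ => T.vProfile κ (p : ℤ × ℤ).2 m x.2 :=
        (T.continuous_vProfile _ _ _).comp continuous_snd
      fun_prop
    have hGq : G (T.pt q) = ∑ m : Fin N, β ⟨q, hq⟩ m * ((-1) ^ (m : ℕ) * z m ^ n) := by
      simp only [hG, pt]
      rw [Finset.sum_eq_single ⟨q, hq⟩]
      · refine Finset.sum_congr rfl fun m _ => ?_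
        rw [hProfile_grid, T.vProfile_grid (hs m)]
        simp
        left; ring
      · intro p _ hp
        refine Finset.sum_eq_zero fun m _ => ?_
        rw [hProfile_grid, T.vProfile_grid (hs m)]
        by_cases e1 : q.1 = (p : ℤ × ℤ).1
        · by_cases e2 : q.2 = (p : ℤ × ℤ).2
          · exact absurd (Subtype.ext (Prod.ext e1.symm e2.symm)) hp
          · simp [e2]
        · simp [e1]
      · simp
    rw [← hGq]
    refine (hGc.continuousAt.tendsto.mono_left nhdsWithin_le_nhds).congr' ?_
    filter_upwards [self_mem_nhdsWithin] with x hx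
    refine Finset.sum_congr rfl fun p _ => Finset.sum_congr rfl fun m _ => ?_
    have e1 : pd1^[2 * n] (T.nodeBasis κ p (m + 1)) =
        fun y => (deriv^[2 * n] fun s => (T.hProfile (p : ℤ × ℤ).1 m s : ℂ)) y.1 *
          T.vProfile κ (p : ℤ × ℤ).2 m y.2 := by
      rw [funext (T.nodeBasis_eq hκ p m)]
      exact iterate_pd1_mul (fun s => (T.hProfile (p : ℤ × ℤ).1 m s : ℂ)) _ _
    rw [e1]
    simp only
    rw [T.iterate_deriv_hProfile _ c.1 m n hx.1, hz]
    simp only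
    have e2 : (-(((2 * (m : ℕ) + 1) * Real.pi / (2 * (κ * T.h₁))) ^ 2 : ℝ) : ℂ) ^ n =
        ((κ : ℂ) ^ (2 * n))⁻¹ * (-(((2 * (m : ℕ) + 1) * Real.pi / (2 * T.h₁) : ℝ) : ℂ) ^ 2) ^ n := by
      rw [pow_mul, ← inv_pow, ← mul_pow]
      congr 1
      push_cast
      field_simp
    rw [e2]; ring
  have hne : ∀ c q, q ∈ vertices c → (𝓝[T.cell c] (T.pt q)).NeBot := fun c q hq =>
    mem_closure_iff_nhdsWithin_neBot.1 (T.pt_mem_closure_cell hq)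
  constructor
  · rintro h ⟨q, hq⟩ n hn
    obtain ⟨c, hc, hqc⟩ := T.mem_nodes_iff.1 hq
    have := hne c q hqc
    exact tendsto_nhds_unique (lim n c q hq hqc) (h n hn c hc q hqc)
  · intro h n hn c hc q hqc
    have hq : q ∈ T.nodes := T.mem_nodes_iff.2 ⟨c, hc, hqc⟩
    have := lim n c q hq hqc
    rwa [h ⟨q, hq⟩ n hn] at this

theorem existsUnique_isCollocation {κ : ℝ} (hκ : 0 < κ)
    (hs : ∀ m : ℕ, Complex.sin (T.h₂ * κ * modeRoot κ (2 * T.h₁) (2 * m + 1)) ≠ 0)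
    (N : ℕ) (u : ℝ × ℝ → ℂ) : ∃! β : T.nodes → Fin N → ℂ, T.IsCollocation κ N u β := by
  have h1 := T.h₁_pos
  have hpi := Real.pi_pos
  simp only [T.isCollocation_iff hκ hs]
  have hinj : Function.Injective fun m : Fin N =>
      (-(((2 * (m : ℕ) + 1) * Real.pi / (2 * (κ * T.h₁))) ^ 2 : ℝ) : ℂ) := by
    intro m m' h
    have h' : ((2 * (m : ℕ) + 1) * Real.pi / (2 * (κ * T.h₁))) ^ 2 =
        ((2 * (m' : ℕ) + 1) * Real.pi / (2 * (κ * T.h₁))) ^ 2 := by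
      exact_mod_cast neg_injective h
    have h2 := (pow_left_inj₀ (by positivity) (by positivity) two_ne_zero).1 h'
    field_simp at h2
    have h3 : ((m : ℕ) : ℝ) = (m' : ℕ) := by linarith
    exact Fin.ext (by exact_mod_cast h3)
  choose g hg hg' using fun q : T.nodes => existsUnique_moments hinj
    (ε := fun m : Fin N => (-1 : ℂ) ^ (m : ℕ)) (fun m => pow_ne_zero _ (by norm_num))
    (fun n => ((κ : ℂ) ^ (2 * n))⁻¹ * (pd1^[2 * n] u) (T.pt q))
  exact ⟨g, hg, fun β hβ => funext fun q => hg' q (β q) (hβ q)⟩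

theorem norm_nodeCoeff_le {κ : ℝ} (hκ : 0 < κ)
    (hs : ∀ m : ℕ, Complex.sin (T.h₂ * κ * modeRoot κ (2 * T.h₁) (2 * m + 1)) ≠ 0)
    (h1 : 1 ≤ κ * T.h₁) (h2 : 1 ≤ κ * T.h₂) {N : ℕ} {u : ℝ × ℝ → ℂ}
    (hu : AnalyticOnNhd ℝ u (closure T.domain)) {β : T.nodes → Fin N → ℂ}
    (hβ : T.IsCollocation κ N u β) (q : T.nodes) (m : Fin N) :
    ‖β q m‖ ≤ 8 * κ * Real.exp (κ * T.h₁) * sobolevNorm κ (2 * N + 1) T.domain u := by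
  obtain ⟨c, hc, hqc⟩ := T.mem_nodes_iff.1 q.2
  have h := (T.isCollocation_iff hκ hs N u β).1 hβ q
  -- The signs `(-1)^i` move into the unknowns, which are extended by zero beyond `N`.
  set γ : ℕ → ℂ := fun i => if hi : i < N then β q ⟨i, hi⟩ * (-1) ^ i else 0 with hγ
  have e : ‖β q m‖ = ‖γ m‖ := by simp [hγ]
  rw [e]
  refine (norm_le_of_odd_moments (a := κ * T.h₁) (by linarith) (γ := γ)
    (f := fun n => ((κ : ℂ) ^ (2 * n))⁻¹ * (pd1^[2 * n] u) (T.pt q))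
    (F := 4 * κ * sobolevNorm κ (2 * N + 1) T.domain u) ?_ ?_ m.2).trans_eq (by ring)
  · intro n hn
    exact norm_vertex_derivative_le hκ h1 h2 hu hc hqc (by omega)
  · intro n hn
    rw [← h n hn, ← Fin.sum_univ_eq_sum_range (fun i => γ i *
      (-(((2 * (i : ℝ) + 1) * Real.pi / (2 * (κ * T.h₁))) ^ 2 : ℝ) : ℂ) ^ n)]
    refine Finset.sum_congr rfl fun i _ => ?_
    simp only [hγ, i.2, dif_pos]
    ring

end Mesh

/-! ### Bessel's inequality on an interval -/

theorem integral_mul_conj_sum {a b : ℝ} (hab : a ≤ b) {s : Finset ℕ} {e : ℕ → ℝ → ℝ}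
    (he : ∀ n, Continuous (e n)) {c : ℝ} {α : ℕ → ℂ} {w : ℝ → ℂ} (hw : ContinuousOn w (Set.Icc a b))
    (h : ∀ n ∈ s, ∫ x in a..b, w x * (e n x : ℂ) = c * α n) :
    ∫ x in a..b, w x * conj (∑ n ∈ s, α n * (e n x : ℂ)) = ((c * ∑ n ∈ s, ‖α n‖ ^ 2 : ℝ) : ℂ) := by
  have hu : Set.uIcc a b = Set.Icc a b := Set.uIcc_of_le hab
  have e1 : ∀ x, w x * conj (∑ n ∈ s, α n * (e n x : ℂ)) =
      ∑ n ∈ s, conj (α n) * (w x * (e n x : ℂ)) := fun x => by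
    rw [map_sum, Finset.mul_sum]
    refine Finset.sum_congr rfl fun n _ => ?_
    rw [map_mul, Complex.conj_ofReal]; ring
  simp only [e1]
  rw [intervalIntegral.integral_finsetSum]
  · push_cast
    rw [Finset.mul_sum]
    refine Finset.sum_congr rfl fun n hn => ?_
    rw [intervalIntegral.integral_const_mul, h n hn, ← Complex.conj_mul']; ring
  · intro n _
    have := he n
    refine ContinuousOn.intervalIntegrable ?_
    rw [hu]
    fun_prop

/-- Let `g` be the projection of `w`. Both `∫ w ḡ` and `∫ |g|²` equal `c ∑ |α|²` by
`integral_mul_conj_sum`; integrating `2 Re (w ḡ) ≤ |w|² + |g|²` gives the bound. -/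
theorem sum_norm_sq_integral_div_le {a b : ℝ} (hab : a ≤ b) {s : Finset ℕ} {e : ℕ → ℝ → ℝ}
    (he : ∀ n, Continuous (e n)) {c : ℝ} (hc : 0 < c)
    (horth : ∀ n ∈ s, ∀ m ∈ s, ∫ x in a..b, e n x * e m x = if n = m then c else 0)
    {w : ℝ → ℂ} (hw : ContinuousOn w (Set.Icc a b)) :
    ∑ n ∈ s, ‖(∫ x in a..b, w x * (e n x : ℂ)) / c‖ ^ 2 ≤ c⁻¹ * ∫ x in a..b, ‖w x‖ ^ 2 := by
  have hu : Set.uIcc a b = Set.Icc a b := Set.uIcc_of_le hab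
  have hc' : (c : ℂ) ≠ 0 := Complex.ofReal_ne_zero.2 hc.ne'
  set α : ℕ → ℂ := fun n => (∫ x in a..b, w x * (e n x : ℂ)) / c with hα
  set g : ℝ → ℂ := fun x => ∑ n ∈ s, α n * (e n x : ℂ) with hg
  have hgc : Continuous g := by
    refine continuous_finsetSum _ fun n _ => ?_
    have := he n
    fun_prop
  have h1 := integral_mul_conj_sum (s := s) (c := c) (α := α) hab he hw
    (fun n _ => by simp only [hα]; field_simp)
  have h2 := integral_mul_conj_sum (s := s) (c := c) (α := α) (w := g) hab he hgc.continuousOn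
    (fun n hn => by
      have e1 : ∀ x, g x * (e n x : ℂ) = ∑ m ∈ s, α m * ((e m x * e n x : ℝ) : ℂ) := fun x => by
        simp only [hg]
        rw [Finset.sum_mul]
        refine Finset.sum_congr rfl fun m _ => ?_
        push_cast; ring
      simp only [e1]
      rw [intervalIntegral.integral_finsetSum]
      · rw [Finset.sum_eq_single_of_mem n hn]
        · rw [intervalIntegral.integral_const_mul, intervalIntegral.integral_ofReal,
            horth n hn n hn, if_pos rfl]; ring
        · intro m hm hmn
          rw [intervalIntegral.integral_const_mul, intervalIntegral.integral_ofReal,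
            horth m hm n hn, if_neg hmn]; simp
      · intro m _
        have := he n
        have := he m
        refine Continuous.intervalIntegrable ?_ _ _
        fun_prop)
  set Q := ∑ n ∈ s, ‖α n‖ ^ 2
  have cw : ContinuousOn (fun x => w x * conj (g x)) (Set.uIcc a b) := by
    rw [hu]
    exact hw.mul (Complex.continuous_conj.comp hgc).continuousOn
  have h1' : ∫ x in a..b, (w x * conj (g x)).re = c * Q := by
    have := Complex.reCLM.intervalIntegral_comp_comm (cw.intervalIntegrable (μ := volume))
    simp only [Complex.reCLM_apply] at this
    rw [this, h1, Complex.ofReal_re]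
  have h2' : ∫ x in a..b, ‖g x‖ ^ 2 = c * Q := by
    have e1 : ∀ x, g x * conj (g x) = ((‖g x‖ ^ 2 : ℝ) : ℂ) := fun x => by
      rw [Complex.mul_conj']; push_cast; rfl
    have h3 : ∫ x in a..b, g x * conj (g x) = ((c * Q : ℝ) : ℂ) := h2
    simp only [e1] at h3
    rw [intervalIntegral.integral_ofReal] at h3
    exact_mod_cast h3
  have i1 : IntervalIntegrable (fun x => ‖w x‖ ^ 2) volume a b := by
    refine ContinuousOn.intervalIntegrable ?_
    rw [hu]; fun_prop
  have i2 : IntervalIntegrable (fun x => ‖g x‖ ^ 2) volume a b := by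
    refine Continuous.intervalIntegrable ?_ _ _
    fun_prop
  have i3 : IntervalIntegrable (fun x => (w x * conj (g x)).re) volume a b :=
    (Complex.continuous_re.comp_continuousOn cw).intervalIntegrable
  have h4 : ∫ x in a..b, 2 * (w x * conj (g x)).re ≤ ∫ x in a..b, (‖w x‖ ^ 2 + ‖g x‖ ^ 2) := by
    refine intervalIntegral.integral_mono_on hab (i3.const_mul 2) (i1.add i2) fun x _ => ?_
    have h5 := (Complex.re_le_norm (w x * conj (g x)))
    rw [norm_mul, Complex.norm_conj] at h5
    nlinarith [sq_nonneg (‖w x‖ - ‖g x‖)]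
  rw [intervalIntegral.integral_const_mul, intervalIntegral.integral_add i1 i2, h1', h2'] at h4
  rw [le_inv_mul_iff₀ hc]
  linarith

/-! ### Sine orthogonality and a lower bound for the sine -/

theorem integral_cos_int_mul {a L : ℝ} (hL : 0 < L) {k : ℤ} (hk : k ≠ 0) :
    ∫ x in a..a + L, Real.cos (k * Real.pi / L * (x - a)) = 0 := by
  have hw : (k : ℝ) * Real.pi / L ≠ 0 :=
    div_ne_zero (mul_ne_zero (Int.cast_ne_zero.2 hk) Real.pi_ne_zero) hL.ne'
  set ω := (k : ℝ) * Real.pi / L with hω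
  have hd : ∀ x ∈ Set.uIcc a (a + L),
      HasDerivAt (fun x => Real.sin (ω * (x - a)) / ω) (Real.cos (ω * (x - a))) x := by
    intro x _
    have h1 : HasDerivAt (fun x => ω * (x - a)) ω x := by
      simpa using ((hasDerivAt_id x).sub_const a).const_mul ω
    have h2 := h1.sin.div_const ω
    rwa [mul_div_cancel_right₀ _ hw] at h2
  rw [intervalIntegral.integral_eq_sub_of_hasDerivAt hd
    (Continuous.intervalIntegrable (by fun_prop) _ _)]
  have e1 : ω * (a + L - a) = k * Real.pi := by rw [hω]; field_simp; ring
  rw [e1, Real.sin_int_mul_pi]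
  simp

theorem integral_sin_mul_sin {a L : ℝ} (hL : 0 < L) {n m : ℕ} (hn : 1 ≤ n) :
    ∫ x in a..a + L, Real.sin (n * Real.pi / L * (x - a)) * Real.sin (m * Real.pi / L * (x - a)) =
      if n = m then L / 2 else 0 := by
  have e1 : ∀ x, Real.sin (n * Real.pi / L * (x - a)) * Real.sin (m * Real.pi / L * (x - a)) =
      (1 / 2) * (Real.cos (((n - m : ℤ) : ℝ) * Real.pi / L * (x - a)) -
        Real.cos (((n + m : ℤ) : ℝ) * Real.pi / L * (x - a))) := fun x => by
    have h1 : ((n - m : ℤ) : ℝ) * Real.pi / L * (x - a) =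
        n * Real.pi / L * (x - a) - m * Real.pi / L * (x - a) := by push_cast; ring
    have h2 : ((n + m : ℤ) : ℝ) * Real.pi / L * (x - a) =
        n * Real.pi / L * (x - a) + m * Real.pi / L * (x - a) := by push_cast; ring
    rw [h1, h2, Real.cos_sub, Real.cos_add]; ring
  simp only [e1]
  rw [intervalIntegral.integral_const_mul, intervalIntegral.integral_sub
    (Continuous.intervalIntegrable (by fun_prop) _ _)
    (Continuous.intervalIntegrable (by fun_prop) _ _),
    integral_cos_int_mul hL (k := (n + m : ℤ)) (by omega)]
  split_ifs with h
  · subst h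
    simp
    ring
  · rw [integral_cos_int_mul hL (by omega)]
    simp

/-- Shift by the nearest multiple of `π` and apply Jordan's inequality; the multiple is nonnegative
because `x` is. -/
theorem two_div_pi_mul_le_abs_sin {x δ : ℝ} (hx : 0 ≤ x) (h : ∀ k : ℕ, δ ≤ |x - k * Real.pi|) :
    2 / Real.pi * δ ≤ |Real.sin x| := by
  have hpi := Real.pi_pos
  have h0 : 0 ≤ round (x / Real.pi) := by
    rw [round_eq]; exact Int.floor_nonneg.2 (by positivity)
  obtain ⟨k, hk⟩ := Int.eq_ofNat_of_zero_le h0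
  have h1 := abs_sub_round (x / Real.pi)
  rw [hk, Int.cast_natCast] at h1
  have h2 : x - k * Real.pi = (x / Real.pi - k) * Real.pi := by field_simp
  have h3 : |x - k * Real.pi| ≤ Real.pi / 2 := by
    rw [h2, abs_mul, abs_of_pos hpi]; nlinarith
  have h4 := Real.mul_abs_le_abs_sin h3
  rw [Real.sin_sub_nat_mul_pi, abs_mul, abs_pow, abs_neg, abs_one, one_pow, one_mul] at h4
  refine le_trans ?_ h4
  have := h k
  gcongr

namespace Mesh

variable {T : Mesh} {κ : ℝ} {u : ℝ × ℝ → ℂ}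

/-! ### Bounds for the nodal interpolant -/

theorem norm_vProfile_le (hκ : 0 < κ) {M : ℝ} (hM : 1 ≤ M) {m : ℕ}
    (h : 0 < 1 - nuHat κ (2 * T.h₁) (2 * m + 1) ^ 2 →
      1 ≤ M * |Real.sin (T.h₂ * κ * √(1 - nuHat κ (2 * T.h₁) (2 * m + 1) ^ 2))|)
    (j : ℤ) (y : ℝ) : ‖T.vProfile κ j m y‖ ≤ M := by
  have h2 := T.h₂_pos
  refine norm_modeRatio_le hκ h2 hM h ⟨le_max_left _ _, max_le h2.le ?_⟩
  linarith [abs_nonneg (y - (T.y₀ + j * T.h₂))]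

theorem continuous_nodalInterpolant (hκ : 0 < κ) {N : ℕ} (β : T.nodes → Fin N → ℂ) :
    Continuous (T.nodalInterpolant κ β) := by
  unfold nodalInterpolant
  refine continuous_finsetSum _ fun p _ => continuous_finsetSum _ fun m _ => ?_
  rw [funext (T.nodeBasis_eq hκ p m)]
  have c1 : Continuous fun x : ℝ × ℝ => T.hProfile (p : ℤ × ℤ).1 m x.1 :=
    (T.continuous_hProfile _ _).comp continuous_fst
  have c2 : Continuous fun x : ℝ × ℝ => T.vProfile κ (p : ℤ × ℤ).2 m x.2 :=
    (T.continuous_vProfile _ _ _).comp continuous_snd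
  fun_prop

/-- On a closed cell only the nodes at its four vertices contribute, whatever the size of the mesh.
-/
theorem norm_nodalInterpolant_le (hκ : 0 < κ) {M b : ℝ} (hM : 1 ≤ M)
    (h : ∀ m : ℕ, 0 < 1 - nuHat κ (2 * T.h₁) (2 * m + 1) ^ 2 →
      1 ≤ M * |Real.sin (T.h₂ * κ * √(1 - nuHat κ (2 * T.h₁) (2 * m + 1) ^ 2))|)
    {N : ℕ} {β : T.nodes → Fin N → ℂ} (hb : 0 ≤ b) (hβ : ∀ q m, ‖β q m‖ ≤ b) {c : ℤ × ℤ}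
    {x : ℝ × ℝ} (hx : x ∈ Set.Icc (T.pt c).1 ((T.pt c).1 + T.h₁) ×ˢ
      Set.Icc (T.pt c).2 ((T.pt c).2 + T.h₂)) :
    ‖T.nodalInterpolant κ β x‖ ≤ 4 * (N * (b * M)) := by
  have h1 := T.h₁_pos
  have h2 := T.h₂_pos
  have hbM : 0 ≤ b * M := by positivity
  have hp : ∀ p : T.nodes, ‖∑ m : Fin N, β p m * T.nodeBasis κ p (m + 1) x‖ ≤
      if (p : ℤ × ℤ) ∈ vertices c then N * (b * M) else 0 := by
    intro p
    split_ifs with hpc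
    · refine (norm_sum_le_of_le (n := fun _ => b * M) _ fun m _ => ?_).trans_eq (by simp)
      rw [T.nodeBasis_eq hκ, norm_mul, norm_mul, Complex.norm_real, Real.norm_eq_abs]
      have e1 := T.abs_hProfile_le (p : ℤ × ℤ).1 m x.1
      have e2 := norm_vProfile_le hκ hM (h m) (p : ℤ × ℤ).2 x.2
      have e3 : |T.hProfile (p : ℤ × ℤ).1 m x.1| * ‖T.vProfile κ (p : ℤ × ℤ).2 m x.2‖ ≤ 1 * M :=
        mul_le_mul e1 e2 (norm_nonneg _) zero_le_one
      rw [one_mul] at e3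
      exact mul_le_mul (hβ p m) e3 (by positivity) hb
    · refine le_of_eq (norm_eq_zero.2 (Finset.sum_eq_zero fun m _ => ?_))
      rw [T.nodeBasis_eq hκ]
      by_cases e1 : (p : ℤ × ℤ).1 = c.1 ∨ (p : ℤ × ℤ).1 = c.1 + 1
      · by_cases e2 : (p : ℤ × ℤ).2 = c.2 ∨ (p : ℤ × ℤ).2 = c.2 + 1
        · refine absurd ?_ hpc
          simp only [vertices, Finset.mem_insert, Finset.mem_singleton, Prod.ext_iff, Prod.fst_add,
            Prod.snd_add]
          omega
        · push Not at e2
          rw [T.vProfile_eq_zero (le_abs_sub_of_mem_Icc h2 e2.1 e2.2 hx.2)]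
          simp
      · push Not at e1
        rw [T.hProfile_eq_zero (le_abs_sub_of_mem_Icc h1 e1.1 e1.2 hx.1)]
        simp
  refine (norm_sum_le_of_le _ fun p _ => hp p).trans ?_
  rw [Finset.sum_coe_sort T.nodes (fun p => if p ∈ vertices c then N * (b * M) else 0),
    Finset.sum_ite_mem, Finset.sum_const, nsmul_eq_mul]
  have hcard : (T.nodes ∩ vertices c).card ≤ 4 :=
    (Finset.card_le_card Finset.inter_subset_right).trans Finset.card_le_four
  have : ((T.nodes ∩ vertices c).card : ℝ) ≤ 4 := by exact_mod_cast hcard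
  gcongr

/-! ### Edge coefficients -/

theorem kappa_mul_nuHat (hκ : 0 < κ) {a : ℝ} (ha : 0 < a) (n : ℕ) :
    κ * nuHat κ a n = n * Real.pi / a := by
  rw [nuHat]; field_simp

theorem edgeBasis_inl (hκ : 0 < κ) (s : ℤ × ℤ) {n : ℕ}
    (h0 : Complex.sin (T.h₂ * κ * modeRoot κ T.h₁ n) ≠ 0) {x : ℝ}
    (hx : x ∈ Set.Icc (T.pt s).1 ((T.pt s).1 + T.h₁)) :
    T.edgeBasis κ (Sum.inl s) n (x, (T.pt s).2) =
      (Real.sin (n * Real.pi / T.h₁ * (x - (T.pt s).1)) : ℂ) := by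
  have h2 := T.h₂_pos
  have hm : (x, (T.pt s).2) ∈ Set.Icc (T.pt s).1 ((T.pt s).1 + T.h₁) ×ˢ
      Set.Icc (T.pt s).2 ((T.pt s).2 + T.h₂) := ⟨hx, le_rfl, by linarith⟩
  simp only [edgeBasis]
  rw [if_pos hm, phiHat, kappa_mul_nuHat hκ T.h₁_pos, sub_self, add_zero, div_self h0, mul_one]

theorem edgeBasis_inr (hκ : 0 < κ) (s : ℤ × ℤ) {n : ℕ}
    (h0 : Complex.sin (T.h₁ * κ * modeRoot κ T.h₂ n) ≠ 0) {y : ℝ}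
    (hy : y ∈ Set.Icc (T.pt s).2 ((T.pt s).2 + T.h₂)) :
    T.edgeBasis κ (Sum.inr s) n ((T.pt s).1, y) =
      (Real.sin (n * Real.pi / T.h₂ * (y - (T.pt s).2)) : ℂ) := by
  have h1 := T.h₁_pos
  have hm : ((T.pt s).1, y) ∈ Set.Icc (T.pt s).1 ((T.pt s).1 + T.h₁) ×ˢ
      Set.Icc (T.pt s).2 ((T.pt s).2 + T.h₂) := ⟨⟨le_rfl, by linarith⟩, hy⟩
  simp only [edgeBasis]
  rw [if_pos hm, phiHat, kappa_mul_nuHat hκ T.h₂_pos, sub_self, add_zero, div_self h0, mul_one]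

/-- Sine coefficients on an interval, in the form in which the edge coefficients are defined. -/
theorem sum_norm_sq_sine_quotient_le {a L : ℝ} (hL : 0 < L) {w : ℝ → ℂ} {φ : ℕ → ℝ → ℂ}
    (hφ : ∀ n, ∀ x ∈ Set.Icc a (a + L), φ n x = (Real.sin (n * Real.pi / L * (x - a)) : ℂ))
    (hw : ContinuousOn w (Set.Icc a (a + L))) (N : ℕ) :
    ∑ n ∈ Finset.Icc 1 N, ‖(∫ x in a..a + L, w x * conj (φ n x)) /
      (∫ x in a..a + L, φ n x * conj (φ n x))‖ ^ 2 ≤ 2 / L * ∫ x in a..a + L, ‖w x‖ ^ 2 := by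
  have hab : a ≤ a + L := by linarith
  have hu : Set.uIcc a (a + L) = Set.Icc a (a + L) := Set.uIcc_of_le hab
  have key := sum_norm_sq_integral_div_le (s := Finset.Icc 1 N) (c := L / 2)
    (e := fun n x => Real.sin (n * Real.pi / L * (x - a))) hab (fun n => by fun_prop)
    (by positivity) (fun n hn m _ => integral_sin_mul_sin hL (Finset.mem_Icc.1 hn).1) hw
  rw [inv_div] at key
  refine le_trans (le_of_eq (Finset.sum_congr rfl fun n hn => ?_)) key
  have e1 : ∫ x in a..a + L, w x * conj (φ n x) =
      ∫ x in a..a + L, w x * (Real.sin (n * Real.pi / L * (x - a)) : ℂ) :=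
    intervalIntegral.integral_congr fun x hx => by
      rw [hφ n x (hu ▸ hx), Complex.conj_ofReal]
  have e2 : ∫ x in a..a + L, φ n x * conj (φ n x) = ((L / 2 : ℝ) : ℂ) := by
    have e3 : ∫ x in a..a + L, φ n x * conj (φ n x) = ∫ x in a..a + L,
        ((Real.sin (n * Real.pi / L * (x - a)) * Real.sin (n * Real.pi / L * (x - a)) : ℝ) : ℂ) :=
      intervalIntegral.integral_congr fun x hx => by
        rw [hφ n x (hu ▸ hx), Complex.conj_ofReal, Complex.ofReal_mul]
    rw [e3, intervalIntegral.integral_ofReal, integral_sin_mul_sin hL (Finset.mem_Icc.1 hn).1,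
      if_pos rfl]
  rw [e1, e2]

theorem integral_norm_sq_sub_le {a L A V : ℝ} (hL : 0 < L) {f g : ℝ → ℂ}
    (hf : ContinuousOn f (Set.Icc a (a + L))) (hg : ContinuousOn g (Set.Icc a (a + L)))
    (hfA : ∫ x in Set.Ioo a (a + L), ‖f x‖ ^ 2 ≤ A) (hgV : ∀ x ∈ Set.Icc a (a + L), ‖g x‖ ≤ V) :
    2 / L * ∫ x in a..a + L, ‖f x - g x‖ ^ 2 ≤ 4 * A / L + 4 * V ^ 2 := by
  have hab : a ≤ a + L := by linarith
  have hu : Set.uIcc a (a + L) = Set.Icc a (a + L) := Set.uIcc_of_le hab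
  have i1 : IntervalIntegrable (fun x => 2 * ‖f x‖ ^ 2) volume a (a + L) := by
    refine ContinuousOn.intervalIntegrable ?_
    rw [hu]; fun_prop
  have h1 : ∫ x in a..a + L, ‖f x - g x‖ ^ 2 ≤ ∫ x in a..a + L, (2 * ‖f x‖ ^ 2 + 2 * V ^ 2) := by
    refine intervalIntegral.integral_mono_on hab ?_ (i1.add intervalIntegrable_const) ?_
    · refine ContinuousOn.intervalIntegrable ?_
      rw [hu]; fun_prop
    · intro x hx
      have h2 := norm_sub_le (f x) (g x)
      have h3 := hgV x hx
      have h4 : ‖f x - g x‖ ^ 2 ≤ (‖f x‖ + V) ^ 2 :=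
        pow_le_pow_left₀ (norm_nonneg _) (h2.trans (by linarith)) 2
      nlinarith [sq_nonneg (‖f x‖ - V)]
  rw [intervalIntegral.integral_add i1 intervalIntegrable_const,
    intervalIntegral.integral_const_mul, intervalIntegral.integral_const,
    intervalIntegral.integral_of_le (f := fun x => ‖f x‖ ^ 2) hab, integral_Ioc_eq_integral_Ioo,
    smul_eq_mul, add_sub_cancel_left] at h1
  calc _ ≤ 2 / L * (2 * A + L * (2 * V ^ 2)) := by
        refine mul_le_mul_of_nonneg_left ?_ (by positivity)
        linarith
    _ = _ := by field_simp; ring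

theorem exists_cell_of_mem_edges {s : (ℤ × ℤ) ⊕ (ℤ × ℤ)} (hs : s ∈ T.edges) :
    ∃ c ∈ T.cells, (∃ p, s = Sum.inl p ∧ (T.pt p).1 = (T.pt c).1 ∧
        ((T.pt p).2 = (T.pt c).2 ∨ (T.pt p).2 = (T.pt c).2 + T.h₂)) ∨
      ∃ p, s = Sum.inr p ∧ (T.pt p).2 = (T.pt c).2 ∧
        ((T.pt p).1 = (T.pt c).1 ∨ (T.pt p).1 = (T.pt c).1 + T.h₁) := by
  obtain ⟨c, hc, h⟩ := Finset.mem_biUnion.1 hs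
  simp only [Finset.mem_insert, Finset.mem_singleton] at h
  refine ⟨c, hc, ?_⟩
  rcases h with rfl | rfl | rfl | rfl
  · exact Or.inl ⟨_, rfl, rfl, Or.inl rfl⟩
  · refine Or.inl ⟨_, rfl, by simp [pt], Or.inr ?_⟩
    simp only [pt, Prod.snd_add]; push_cast; ring
  · exact Or.inr ⟨_, rfl, rfl, Or.inl rfl⟩
  · refine Or.inr ⟨_, rfl, by simp [pt], Or.inr ?_⟩
    simp only [pt, Prod.fst_add]; push_cast; ring

theorem card_edges_le : T.edges.card ≤ 4 * T.nodes.card := by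
  have h1 : T.cells.card ≤ T.nodes.card :=
    Finset.card_le_card fun c hc => T.mem_nodes_iff.2 ⟨c, hc, by simp [vertices]⟩
  have h2 : T.edges.card ≤ T.cells.card * 4 :=
    Finset.card_biUnion_le_card_mul _ _ _ fun c _ => Finset.card_le_four
  omega

theorem sum_edgeCoeff_sq_le (hκ : 0 < κ) (hspec : κ ^ 2 ∉ neumannSpectrum (2 * T.h₁) T.h₂)
    (h1 : 1 ≤ κ * T.h₁) (h2 : 1 ≤ κ * T.h₂) (hu : AnalyticOnNhd ℝ u (closure T.domain))
    {N M : ℕ} (hM : 1 ≤ M) {β : T.nodes → Fin N → ℂ} {V H : ℝ} (hH : 0 < H) (hH1 : H ≤ T.h₁)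
    (hH2 : H ≤ T.h₂)
    (hV : ∀ c ∈ T.cells, ∀ x ∈ Set.Icc (T.pt c).1 ((T.pt c).1 + T.h₁) ×ˢ
      Set.Icc (T.pt c).2 ((T.pt c).2 + T.h₂), ‖T.nodalInterpolant κ β x‖ ≤ V)
    (Ne : ℕ) {s : (ℤ × ℤ) ⊕ (ℤ × ℤ)} (hs : s ∈ T.edges) :
    ∑ n ∈ Finset.Icc 1 Ne, ‖T.edgeCoeff κ u β s n‖ ^ 2 ≤
      16 * κ * sobolevNorm κ M T.domain u ^ 2 / H + 4 * V ^ 2 := by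
  have p1 := T.h₁_pos
  have p2 := T.h₂_pos
  obtain ⟨c, hc, hs⟩ := exists_cell_of_mem_edges hs
  have hu' := analyticAt_of_mem_cell hu hc
  have huc := continuousOn_of_analyticAt hu'
  set S := sobolevNorm κ M T.domain u
  have a0 := integral_cell_le_sobolevNorm (M := M) (i := 0) (j := 0) hκ hu hc (by omega)
  have a1 := integral_cell_le_sobolevNorm (M := M) (i := 1) (j := 0) hκ hu hc (by omega)
  have a2 := integral_cell_le_sobolevNorm (M := M) (i := 0) (j := 1) hκ hu hc (by omega)
  simp only [Function.iterate_zero, id, Function.iterate_one, add_zero, zero_add, mul_zero,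
    pow_zero, inv_one, one_mul, mul_one] at a0 a1 a2
  have fin : ∀ {L : ℝ}, H ≤ L → 4 * (2 * κ * (S ^ 2 + S ^ 2)) / L + 4 * V ^ 2 ≤
      16 * κ * S ^ 2 / H + 4 * V ^ 2 := by
    intro L hL
    have : 4 * (2 * κ * (S ^ 2 + S ^ 2)) / L = 16 * κ * S ^ 2 / L := by ring
    rw [this]
    gcongr
  rcases hs with ⟨p, rfl, e1, e2⟩ | ⟨p, rfl, e1, e2⟩
  · have hmem : (T.pt p).2 ∈ Set.Icc (T.pt c).2 ((T.pt c).2 + T.h₂) := by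
      rcases e2 with h | h <;> rw [h] <;> constructor <;> linarith
    have hmaps : Set.MapsTo (fun x => (x, (T.pt p).2)) (Set.Icc (T.pt p).1 ((T.pt p).1 + T.h₁))
        (Set.Icc (T.pt c).1 ((T.pt c).1 + T.h₁) ×ˢ Set.Icc (T.pt c).2 ((T.pt c).2 + T.h₂)) :=
      fun x hx => ⟨e1 ▸ hx, hmem⟩
    have cu : ContinuousOn (fun x => u (x, (T.pt p).2))
        (Set.Icc (T.pt p).1 ((T.pt p).1 + T.h₁)) := huc.comp (by fun_prop) hmaps
    have cV : ContinuousOn (fun x => T.nodalInterpolant κ β (x, (T.pt p).2))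
        (Set.Icc (T.pt p).1 ((T.pt p).1 + T.h₁)) :=
      (continuous_nodalInterpolant hκ β).comp_continuousOn (by fun_prop)
    have tr := integral_horizontal_trace_le (a := (T.pt c).1) (b := (T.pt c).1 + T.h₁)
      hκ (by simpa using h2) hu' e2
    rw [← cell] at tr
    -- Index `n` on length `h₁` is index `2n` on length `2h₁`, so the hypothesis on the `2h₁ × h₂`
    -- spectrum also keeps the edge denominators nonzero.
    refine (sum_norm_sq_sine_quotient_le p1 (w := fun x => (u - T.nodalInterpolant κ β)
      (x, (T.pt p).2)) (φ := fun n x => T.edgeBasis κ (Sum.inl p) n (x, (T.pt p).2))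
      (fun n x hx => edgeBasis_inl hκ p (sin_mul_modeRoot_ne_zero hκ p1 p2 fun m hm => hspec
        ⟨2 * n, m, ?_⟩) hx) (cu.sub cV) Ne).trans
      ((integral_norm_sq_sub_le (A := 2 * κ * (S ^ 2 + S ^ 2)) p1 cu cV ?_
        fun x hx => hV c hc _ (hmaps hx)).trans (fin hH1))
    · rw [hm]; push_cast; field_simp
    · rw [e1]
      exact tr.trans (mul_le_mul_of_nonneg_left (add_le_add a0 a2) (by positivity))
  · have hmem : (T.pt p).1 ∈ Set.Icc (T.pt c).1 ((T.pt c).1 + T.h₁) := by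
      rcases e2 with h | h <;> rw [h] <;> constructor <;> linarith
    have hmaps : Set.MapsTo (fun y => ((T.pt p).1, y)) (Set.Icc (T.pt p).2 ((T.pt p).2 + T.h₂))
        (Set.Icc (T.pt c).1 ((T.pt c).1 + T.h₁) ×ˢ Set.Icc (T.pt c).2 ((T.pt c).2 + T.h₂)) :=
      fun y hy => ⟨hmem, e1 ▸ hy⟩
    have cu : ContinuousOn (fun y => u ((T.pt p).1, y))
        (Set.Icc (T.pt p).2 ((T.pt p).2 + T.h₂)) := huc.comp (by fun_prop) hmaps
    have cV : ContinuousOn (fun y => T.nodalInterpolant κ β ((T.pt p).1, y))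
        (Set.Icc (T.pt p).2 ((T.pt p).2 + T.h₂)) :=
      (continuous_nodalInterpolant hκ β).comp_continuousOn (by fun_prop)
    have tr := integral_vertical_trace_le (c := (T.pt c).2) (d := (T.pt c).2 + T.h₂)
      hκ (by simpa using h1) hu' e2
    rw [← cell] at tr
    -- For a vertical edge the two indices exchange roles: the transverse one, along `h₁`, is
    -- doubled.
    refine (sum_norm_sq_sine_quotient_le p2 (w := fun y => (u - T.nodalInterpolant κ β)
      ((T.pt p).1, y)) (φ := fun n y => T.edgeBasis κ (Sum.inr p) n ((T.pt p).1, y))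
      (fun n y hy => edgeBasis_inr hκ p (sin_mul_modeRoot_ne_zero hκ p2 p1 fun m hm => hspec
        ⟨2 * m, n, ?_⟩) hy) (cu.sub cV) Ne).trans
      ((integral_norm_sq_sub_le (A := 2 * κ * (S ^ 2 + S ^ 2)) p2 cu cV ?_
        fun y hy => hV c hc _ (hmaps hy)).trans (fin hH2))
    · rw [hm]; push_cast; field_simp; ring
    · rw [e1]
      exact tr.trans (mul_le_mul_of_nonneg_left (add_le_add a0 a1) (by positivity))

end Mesh

/-! ### Distance to the resonances -/

theorem inv_le_abs_of_DTilde_le {a b B : ℝ} (hB : 0 < B) (h : DTilde a b ≤ ENNReal.ofReal B)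
    {n : ℕ} (hn : 1 ≤ n) (hν : nuTilde a n < 1) (k : ℕ) :
    B⁻¹ ≤ |√(1 - nuTilde a n ^ 2) - k * Real.pi / b| := by
  have h1 : (dTilde a b)⁻¹ ≤ ENNReal.ofReal B := by
    refine le_trans ?_ h
    rw [DTilde, add_right_comm]
    exact le_add_self
  have h2 : ENNReal.ofReal B⁻¹ ≤ dTilde a b := by
    rw [ENNReal.ofReal_inv_of_pos hB]
    exact ENNReal.inv_le_iff_inv_le.1 h1
  have h3 : dTilde a b ≤ ENNReal.ofReal |√(1 - nuTilde a n ^ 2) - k * Real.pi / b| :=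
    (iInf_le _ k).trans ((iInf_le _ n).trans ((iInf_le _ hn).trans (iInf_le _ hν)))
  exact (ENNReal.ofReal_le_ofReal_iff (abs_nonneg _)).1 (h2.trans h3)

theorem IsAdmissible.exists_DTilde_le {σ₁ σ₂ : ℝ} {K : Set ℝ} (hK : IsAdmissible σ₁ σ₂ K) :
    ∃ B : ℝ, 1 ≤ B ∧ ∀ t ∈ K, DTilde (σ₁ * t) (σ₂ * t) ≤ ENNReal.ofReal (B * t ^ 2) := by
  obtain ⟨h0, -, hfin⟩ := hK
  set Φ := ⨆ t ∈ K, DTilde (σ₁ * t) (σ₂ * t) / ENNReal.ofReal (t ^ 2)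
  -- The added `1` secures `B ≥ 1`, so that `κh₁, κh₂ ≥ 2B` later also gives the condition `≥ 1` of
  -- the trace inequalities.
  refine ⟨Φ.toReal + 1, by linarith [ENNReal.toReal_nonneg (a := Φ)], fun t ht => ?_⟩
  have ht0 : 0 < t := h0 ht
  have h1 : DTilde (σ₁ * t) (σ₂ * t) / ENNReal.ofReal (t ^ 2) ≤ Φ :=
    le_iSup₂ (f := fun t (_ : t ∈ K) => DTilde (σ₁ * t) (σ₂ * t) / ENNReal.ofReal (t ^ 2)) t ht
  have h2 : Φ ≤ ENNReal.ofReal (Φ.toReal + 1) := by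
    refine (ENNReal.ofReal_toReal hfin.ne).symm.le.trans (ENNReal.ofReal_le_ofReal (by linarith))
  rw [ENNReal.ofReal_mul (by positivity)]
  have h3 := ENNReal.div_le_iff (ENNReal.ofReal_pos.2 (by positivity : 0 < t ^ 2)).ne'
    ENNReal.ofReal_ne_top |>.1 (h1.trans h2)
  exact h3

/-- The indicator bound puts the root at distance `1/(Bt²)` from each `kπ/(κh₂)`. Multiplication by
`κh₂ = σt` turns this into a distance of the phase from `kπ`, hence into a lower bound for the sine.
-/
theorem one_le_mul_abs_sin_of_DTilde_le {T : Mesh} {κ B σ t : ℝ} (hB : 0 < B)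
    (ht : 0 < t) (hσ : 0 < σ) (hσt : T.h₂ * κ = σ * t) (hBσ : 2 * B ≤ σ * t)
    (h : DTilde (κ * T.h₁) (σ * t) ≤ ENNReal.ofReal (B * t ^ 2)) {m : ℕ}
    (hm : 0 < 1 - nuHat κ (2 * T.h₁) (2 * m + 1) ^ 2) :
    1 ≤ t ^ 2 * |Real.sin (T.h₂ * κ * √(1 - nuHat κ (2 * T.h₁) (2 * m + 1) ^ 2))| := by
  have h1 := T.h₁_pos
  have hpi := Real.pi_pos
  have hν : nuTilde (κ * T.h₁) (m + 1) = nuHat κ (2 * T.h₁) (2 * m + 1) := by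
    rw [nuTilde, nuHat]
    push_cast
    congr 1 <;> ring
  have hlt : nuTilde (κ * T.h₁) (m + 1) < 1 := by
    rw [hν]; nlinarith
  have hdist := inv_le_abs_of_DTilde_le (by positivity) h (by omega) hlt
  rw [hν] at hdist
  set r := √(1 - nuHat κ (2 * T.h₁) (2 * m + 1) ^ 2)
  have hr : 0 ≤ r := Real.sqrt_nonneg _
  have hb : 0 < σ * t := by positivity
  rw [hσt]
  have hs := two_div_pi_mul_le_abs_sin (x := σ * t * r) (δ := σ * t * (B * t ^ 2)⁻¹)
    (by positivity) fun k => by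
      have e : σ * t * r - k * Real.pi = σ * t * (r - k * Real.pi / (σ * t)) := by field_simp
      rw [e, abs_mul, abs_of_pos hb]
      exact mul_le_mul_of_nonneg_left (hdist k) hb.le
  have h2 : 1 ≤ t ^ 2 * (2 / Real.pi * (σ * t * (B * t ^ 2)⁻¹)) := by
    have e : t ^ 2 * (2 / Real.pi * (σ * t * (B * t ^ 2)⁻¹)) = 2 * (σ * t) / (Real.pi * B) := by
      field_simp
    rw [e, le_div_iff₀ (by positivity)]
    -- What is needed is `πB ≤ 2σt`, which follows from `2B ≤ σt` and `π ≤ 4`.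
    nlinarith [Real.pi_le_four]
  exact h2.trans (mul_le_mul_of_nonneg_left hs (by positivity))

/-! ### Collecting powers -/

section Powers

variable {ρ τ t h κ S E n N : ℝ}

/-- The trace of `u` contributes `t` and the interpolant `t⁸` to the squared norm, both within the
available `t¹⁰`; likewise the edge count, linear in `n`, is absorbed by `n²`. -/
theorem edge_power_bound (hρ : 1 ≤ ρ) (hτ : 1 ≤ τ) (ht : 1 ≤ t) (hh : 0 < h) (hκ : κ * h = t)
    (hE : 1 ≤ E) (hS : 0 ≤ S) (hn : 0 ≤ n) (hn2 : n ≤ n ^ 2) (hN0 : 0 ≤ N) (hN : N ≤ τ * t) :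
    4 * n * (16 * κ * S ^ 2 / (h / ρ) + 4 * (4 * (N * (8 * κ * E * S * t ^ 2))) ^ 2) ≤
      (1000 * ρ * (1 + τ) / h * n * t ^ 5 * E * S) ^ 2 := by
  have hκt : κ = t / h := by rw [← hκ]; field_simp
  subst hκt
  have ht0 : 0 < t := by linarith
  have f1 : t ≤ E ^ 2 * t ^ 10 := by
    have h1 : t ^ 1 ≤ t ^ 10 := pow_le_pow_right₀ ht (by norm_num)
    have h2 : t ^ 10 ≤ E ^ 2 * t ^ 10 :=
      le_mul_of_one_le_left (by positivity) (one_le_pow₀ hE)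
    linarith
  have f2 : E ^ 2 * t ^ 8 ≤ E ^ 2 * t ^ 10 :=
    mul_le_mul_of_nonneg_left (pow_le_pow_right₀ ht (by norm_num)) (by positivity)
  have f3 : 64 * ρ + 16384 * τ ^ 2 ≤ (1000 * ρ * (1 + τ)) ^ 2 := by
    have g1 : ρ ≤ ρ ^ 2 := by nlinarith
    have g2 : 1 ≤ ρ ^ 2 := one_le_pow₀ hρ
    have g3 : 0 ≤ τ ^ 2 := sq_nonneg _
    have g4 : (1000 * ρ * (1 + τ)) ^ 2 =
        1000000 * (ρ ^ 2 + 2 * (ρ ^ 2 * τ) + ρ ^ 2 * τ ^ 2) := by ring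
    have g5 : 0 ≤ ρ ^ 2 * τ := by positivity
    have g6 : τ ^ 2 ≤ ρ ^ 2 * τ ^ 2 := le_mul_of_one_le_left g3 g2
    rw [g4]; linarith
  calc _ ≤ 4 * n * (16 * (t / h) * S ^ 2 / (h / ρ) +
        4 * (4 * ((τ * t) * (8 * (t / h) * E * S * t ^ 2))) ^ 2) := by gcongr
    _ = n * (S / h) ^ 2 * (64 * ρ * t + 16384 * τ ^ 2 * (E ^ 2 * t ^ 8)) := by
        field_simp; ring
    _ ≤ n ^ 2 * (S / h) ^ 2 * (64 * ρ * (E ^ 2 * t ^ 10) + 16384 * τ ^ 2 * (E ^ 2 * t ^ 10)) := by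
        gcongr
    _ = n ^ 2 * (S / h) ^ 2 * ((64 * ρ + 16384 * τ ^ 2) * (E ^ 2 * t ^ 10)) := by ring
    _ ≤ n ^ 2 * (S / h) ^ 2 * ((1000 * ρ * (1 + τ)) ^ 2 * (E ^ 2 * t ^ 10)) := by gcongr
    _ = _ := by field_simp

theorem node_power_bound (hρ : 1 ≤ ρ) (hτ : 1 ≤ τ) (ht : 1 ≤ t) (hh : 0 < h) (hκ : κ * h = t)
    (hE : 1 ≤ E) (hn : 0 ≤ n) (hN : N ≤ τ * t) :
    n * (N * (8 * κ * E * S) ^ 2) ≤ (1000 * ρ * (1 + τ) / h * √(n * t ^ 3) * E * S) ^ 2 := by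
  have hκt : κ = t / h := by rw [← hκ]; field_simp
  subst hκt
  have ht0 : 0 < t := by linarith
  have f4 : 64 * τ ≤ (1000 * ρ * (1 + τ)) ^ 2 := by
    have g2 : 1 ≤ ρ ^ 2 := one_le_pow₀ hρ
    have g3 : (1000 * ρ * (1 + τ)) ^ 2 = ρ ^ 2 * (1000000 * (1 + τ) ^ 2) := by ring
    rw [g3]
    nlinarith [le_mul_of_one_le_left (by positivity : 0 ≤ 1000000 * (1 + τ) ^ 2) g2]
  have e : (1000 * ρ * (1 + τ) / h * √(n * t ^ 3) * E * S) ^ 2 =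
      (1000 * ρ * (1 + τ)) ^ 2 * (√(n * t ^ 3) ^ 2 * E ^ 2 * S ^ 2 / h ^ 2) := by ring
  rw [e, Real.sq_sqrt (by positivity)]
  calc _ ≤ n * ((τ * t) * (8 * (t / h) * E * S) ^ 2) := by gcongr
    _ = 64 * τ * (n * t ^ 3 * E ^ 2 * S ^ 2 / h ^ 2) := by field_simp; ring
    _ ≤ _ := by gcongr

end Powers

end EdgeNodeTrefftz

end

/-! ### Assembly of the two stability bounds -/

open EdgeNodeTrefftz in
theorem mainTheorem7 (ρ : ℝ) (hρ : 1 ≤ ρ) (hρQ : ∃ r : ℚ, ρ ^ 2 = (r : ℝ)) :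
    ∃ C : ℝ → ℝ, Continuous C ∧ (∀ τ, 0 < C τ) ∧
      ∀ σ₁ σ₂ : ℝ, (σ₁ = 1 ∧ σ₂ = 1 / ρ) ∨ (σ₁ = 1 / ρ ∧ σ₂ = 1) →
      ∀ K : Set ℝ, IsAdmissible σ₁ σ₂ K →
      ∃ t₀ : ℝ, ∀ (κ : ℝ) (T : Mesh), 0 < κ →
        T.h₁ = σ₁ * T.h → T.h₂ = σ₂ * T.h →
        κ * T.h ∈ K → t₀ ≤ κ * T.h →
        κ ^ 2 ∉ neumannSpectrum (2 * T.h₁) T.h₂ →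
      ∀ (τe τn : ℝ) (Ne Nn : ℕ), 1 ≤ τe → 1 ≤ τn → 1 ≤ Ne → 1 ≤ Nn →
        (Ne : ℝ) = τe / Real.pi * (κ * T.h) → (Nn : ℝ) = τn / Real.pi * (κ * T.h) →
      ∀ u : ℝ × ℝ → ℂ, AnalyticOnNhd ℝ u (closure T.domain) → IsHelmholtzOn κ u T.domain →
        (∃! β : T.nodes → Fin Nn → ℂ, T.IsCollocation κ Nn u β) ∧
        ∀ β : T.nodes → Fin Nn → ℂ, T.IsCollocation κ Nn u β →
          T.edgeCoeffNorm κ Ne u β ≤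
            C τn / T.h * (T.nodes.card : ℝ) * (κ * T.h) ^ 5 * Real.exp (κ * T.h) *
              sobolevNorm κ (2 * Nn + 1) T.domain u ∧
          T.nodeCoeffNorm β ≤
            C τn / T.h * √((T.nodes.card : ℝ) * (κ * T.h) ^ 3) * Real.exp (κ * T.h) *
              sobolevNorm κ (2 * Nn + 1) T.domain u := by
  have hρ0 : 0 < ρ := by linarith
  -- The absolute value makes the constant positive for every real `τ` while keeping it continuous.
  refine ⟨fun τ => 1000 * ρ * (1 + |τ|), by fun_prop, fun τ => by positivity, ?_⟩
  intro σ₁ σ₂ hσ K hK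
  obtain ⟨B, hB1, hB⟩ := hK.exists_DTilde_le
  have hinv : 1 / ρ ≤ 1 := by rw [div_le_one hρ0]; exact hρ
  have hσ₁ : 1 / ρ ≤ σ₁ := by rcases hσ with ⟨rfl, rfl⟩ | ⟨rfl, rfl⟩ <;> first | exact hinv | rfl
  have hσ₂ : 1 / ρ ≤ σ₂ := by rcases hσ with ⟨rfl, rfl⟩ | ⟨rfl, rfl⟩ <;> first | rfl | exact hinv
  -- As `σ₁, σ₂ ≥ 1/ρ`, this threshold forces `κh₁, κh₂ ≥ 2B`, which serves both the trace
  -- inequalities and the sine bound.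
  refine ⟨2 * B * ρ, ?_⟩
  intro κ T hκ hT₁ hT₂ htK ht hspec τe τn Ne Nn _ hτn _ _ _ hNn u hu _
  set t := κ * T.h with ht_def
  have p1 := T.h₁_pos
  have p2 := T.h₂_pos
  have hh1 : T.h₁ ≤ T.h := le_max_left _ _
  have hh : 0 < T.h := p1.trans_le hh1
  have ht0 : 0 < t := mul_pos hκ hh
  have hpi := Real.pi_pos
  have hi0 : 0 < 1 / ρ := by positivity
  have hBt : 2 * B ≤ 1 / ρ * t := by
    rw [div_mul_eq_mul_div, one_mul, le_div_iff₀ hρ0]; exact ht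
  have hge : ∀ σ, 1 / ρ ≤ σ → 2 * B ≤ σ * t := fun σ h => hBt.trans (by gcongr)
  have e1 : κ * T.h₁ = σ₁ * t := by rw [hT₁, ht_def]; ring
  have e2 : κ * T.h₂ = σ₂ * t := by rw [hT₂, ht_def]; ring
  have k1 : 1 ≤ κ * T.h₁ := by rw [e1]; linarith [hge σ₁ hσ₁]
  have k2 : 1 ≤ κ * T.h₂ := by rw [e2]; linarith [hge σ₂ hσ₂]
  have ht1 : 1 ≤ t := k1.trans (by rw [ht_def]; gcongr)
  have hs : ∀ m : ℕ, Complex.sin (T.h₂ * κ * modeRoot κ (2 * T.h₁) (2 * m + 1)) ≠ 0 := fun m =>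
    sin_mul_modeRoot_ne_zero hκ (by positivity) p2 fun k hk => hspec ⟨2 * m + 1, k, hk⟩
  refine ⟨T.existsUnique_isCollocation hκ hs Nn u, fun β hβ => ?_⟩
  set S := sobolevNorm κ (2 * Nn + 1) T.domain u
  have hS : 0 ≤ S := Real.sqrt_nonneg _
  set E := Real.exp t
  have hE : 1 ≤ E := Real.one_le_exp ht0.le
  set b := 8 * κ * E * S with hb_def
  have hb : 0 ≤ b := by positivity
  have hβb : ∀ q m, ‖β q m‖ ≤ b := fun q m => by
    refine (Mesh.norm_nodeCoeff_le T hκ hs k1 k2 hu hβ q m).trans ?_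
    have : Real.exp (κ * T.h₁) ≤ E := Real.exp_le_exp.2 (by rw [ht_def]; gcongr)
    rw [hb_def]; gcongr
  have hNn' : (Nn : ℝ) ≤ τn * t := by
    rw [hNn]
    refine mul_le_mul_of_nonneg_right (div_le_self (by linarith) ?_) ht0.le
    linarith [Real.pi_gt_three]
  have hτ : |τn| = τn := abs_of_nonneg (by linarith)
  have hn2 : (T.nodes.card : ℝ) ≤ (T.nodes.card : ℝ) ^ 2 := by
    exact_mod_cast Nat.le_self_pow two_ne_zero _
  simp only [hτ]
  constructor
  · have hD := hB t htK
    rw [← e1] at hD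
    have hV : ∀ c ∈ T.cells, ∀ x ∈ Set.Icc (T.pt c).1 ((T.pt c).1 + T.h₁) ×ˢ
        Set.Icc (T.pt c).2 ((T.pt c).2 + T.h₂),
        ‖T.nodalInterpolant κ β x‖ ≤ 4 * (Nn * (b * t ^ 2)) := fun c _ x hx =>
      Mesh.norm_nodalInterpolant_le hκ (one_le_pow₀ ht1) (fun m hm =>
        one_le_mul_abs_sin_of_DTilde_le (by linarith) ht0 (hi0.trans_le hσ₂)
          (by rw [mul_comm, e2]) (hge σ₂ hσ₂) hD hm) hb hβb hx
    have hH1 : T.h / ρ ≤ T.h₁ := by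
      rw [hT₁, div_eq_mul_one_div, mul_comm]; gcongr
    have hH2 : T.h / ρ ≤ T.h₂ := by
      rw [hT₂, div_eq_mul_one_div, mul_comm]; gcongr
    have key := fun s (hs : s ∈ T.edges) => Mesh.sum_edgeCoeff_sq_le (M := 2 * Nn + 1) hκ hspec
      k1 k2 hu (by omega) (by positivity) hH1 hH2 hV Ne hs
    have hsum := Finset.sum_le_card_nsmul _ _ _ key
    have hcard : (T.edges.card : ℝ) ≤ 4 * (T.nodes.card : ℝ) := by
      exact_mod_cast Mesh.card_edges_le (T := T)
    rw [Mesh.edgeCoeffNorm]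
    refine Real.sqrt_le_iff.2 ⟨by positivity, hsum.trans ?_⟩
    rw [nsmul_eq_mul]
    refine (mul_le_mul_of_nonneg_right hcard (by positivity)).trans ?_
    exact edge_power_bound hρ hτn ht1 hh rfl hE hS (Nat.cast_nonneg _) hn2 (Nat.cast_nonneg _) hNn'
  · rw [Mesh.nodeCoeffNorm]
    refine Real.sqrt_le_iff.2 ⟨by positivity, ?_⟩
    have hsum : ∑ p : T.nodes, ∑ m : Fin Nn, ‖β p m‖ ^ 2 ≤ T.nodes.card * (Nn * b ^ 2) := by
      calc _ ≤ ∑ p : T.nodes, ∑ m : Fin Nn, b ^ 2 := by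
            gcongr with p _ m _
            exact hβb p m
        _ = _ := by simp
    exact hsum.trans (node_power_bound hρ hτn ht1 hh rfl hE (Nat.cast_nonneg _) hNn')
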